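/- Let $M$ be a compact complex manifold of complex dimension $n$ with a smooth Hermitian metric $g$, and let $\omega(u,v)=g(Ju,v)$ be its Kähler form, $\omega=\frac{\sqrt{-1}}{2}g_{i\bar j}\,dz^i\wedge d\bar z^j$ in holomorphic coordinates. Let $\partial^*$ and $\bar\partial^*$ denote the $L^2$-adjoints of $\partial:\Lambda^{0,1}\to\Lambda^{1,1}$ and $\bar\partial:\Lambda^{1,0}\to\Lambda^{1,1}$ with respect to the Riemannian volume $dV_g$ and the pointwise pairings $g^{\bar k l}\alpha_{\bar k}\overline{\beta_{\bar l}}$ of $(0,1)$-forms, $g^{i\bar j}\alpha_i\overline{\beta_j}$ of $(1,0)$-forms and $g^{\bar i j}g^{\bar k l}\varphi_{j\bar k}\overline{\psi_{i\bar l}}$ of $(1,1)$-forms. Assume that $g$ is static with constant $\lambda\in\mathbb R$, that is: $g$ is pluriclosed ($\partial\bar\partial\omega=0$), $\mathrm{Vol}(g)=1$, and $$-\partial\partial^*\omega-\bar\partial\bar\partial^*\omega-\tfrac{\sqrt{-1}}{2}\,\partial\bar\partial\log\det g=\lambda\,\omega .$$ If $\lambda\neq0$, then $M$ is a Hermitian-symplectic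 manifold, i.e. it carries a smooth real closed two-form whose $(1,1)$-part is positive definite. Specifically, the two-form $$\tilde\omega=\omega-\frac1\lambda\left(\bar\partial\partial^*\omega+\partial\bar\partial^*\omega\right)$$ is smooth, real and closed, and its $(1,1)$-part is $\omega$; so $\tilde\omega$ is a Hermitian-symplectic form. Moreover $$\int_M\tilde\omega^{\wedge n}>0 ,$$ where $M$ carries its complex orientation. -/

import Mathlib

open scoped Manifold ContDiff Topology

noncomputable section

namespace HermGeom

/-! ### Complex manifolds and complex-valued differential forms

A complex manifold of dimension `n` is a space `M` charted on `ℂⁿ = (Fin n → ℂ)` with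
`IsManifold 𝓘(ℂ, Fin n → ℂ) ω M`.  As everywhere in Mathlib, the tangent space at `x` is a copy of
the model space, the identification being the differential of the preferred chart `chartAt _ x`;
multiplication by `Complex.I` is the complex structure `J`. -/

/-- The model space `ℂⁿ`. -/
abbrev Model (n : ℕ) : Type := Fin n → ℂ

/-- The complex structure `J` as a real linear map. -/
def mulI (n : ℕ) : Model n →L[ℝ] Model n :=
  (Complex.I • ContinuousLinearMap.id ℂ (Model n)).restrictScalars ℝ

/-- Complex-valued (real multilinear, alternating) `k`-forms on the `2n`-dimensional real vector
space `ℂⁿ`. -/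
abbrev Alt (n k : ℕ) : Type := Model n [⋀^Fin k]→L[ℝ] ℂ

/-- A (not necessarily smooth) complex-valued differential `k`-form on `M`: at every point `x` an
alternating form on `T_x M`. -/
abbrev DForm (n : ℕ) (M : Type*) (k : ℕ) : Type _ := M → Alt n k

section Forms

variable {n k : ℕ} {M : Type*} [TopologicalSpace M] [ChartedSpace (Model n) M]

/-- The differential `T_z ℂⁿ → T_y M` at `z` of the inverse of the chart `chartAt c`, where
`y = (chartAt c)⁻¹ z`. -/
def chartInvDerivC (c : M) (z : Model n) : Model n →L[ℂ] Model n :=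
  mfderiv 𝓘(ℂ, Model n) 𝓘(ℂ, Model n) (chartAt (Model n) c).symm z

/-- The same differential as a real linear map. -/
def chartInvDeriv (c : M) (z : Model n) : Model n →L[ℝ] Model n :=
  (chartInvDerivC c z).restrictScalars ℝ

/-- The expression of a form in the chart `chartAt c`, i.e. its pullback under the inverse chart.
It is meaningful on the target of the chart. -/
def inChart (α : DForm n M k) (c : M) (z : Model n) : Alt n k :=
  (α ((chartAt (Model n) c).symm z)).compContinuousLinearMap (chartInvDeriv c z)

/-- Smooth forms. -/
def IsSmooth (α : DForm n M k) : Prop :=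
  ∀ c : M, ContDiffOn ℝ ∞ (inChart α c) (chartAt (Model n) c).target

/-- The exterior derivative, computed in charts. -/
def extD (α : DForm n M k) : DForm n M (k + 1) :=
  fun x => extDeriv (inChart α x) (chartAt (Model n) x x)

end Forms

section Dolbeault

variable {n k : ℕ} {V : Type*} [NormedAddCommGroup V] [NormedSpace ℂ V]

/-- The complex linear part `u ↦ (DF(u) - i DF(iu)) / 2` of the real derivative of `F`:
for `u = e_j` this is the Wirtinger derivative `∂F/∂z_j`. -/
def wirtinger (F : Model n → V) (z : Model n) : Model n →L[ℝ] V :=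
  (1 / 2 : ℂ) • (fderiv ℝ F z - Complex.I • (fderiv ℝ F z).comp (mulI n))

/-- The conjugate linear part `u ↦ (DF(u) + i DF(iu)) / 2` of the real derivative of `F`:
for `u = e_j` this is the Wirtinger derivative `∂F/∂z̄_j`. -/
def wirtingerBar (F : Model n → V) (z : Model n) : Model n →L[ℝ] V :=
  (1 / 2 : ℂ) • (fderiv ℝ F z + Complex.I • (fderiv ℝ F z).comp (mulI n))

/-- The operator `∂` on `ℂⁿ`: `∂(f dz_I ∧ dz̄_J) = ∑ j, (∂f/∂z_j) dz_j ∧ dz_I ∧ dz̄_J`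
(compare `extDeriv`, which is the same expression with the full derivative). -/
def delModel (F : Model n → Alt n k) (z : Model n) : Alt n (k + 1) :=
  ContinuousAlternatingMap.alternatizeUncurryFin (wirtinger F z)

/-- The operator `∂̄` on `ℂⁿ`. -/
def delbarModel (F : Model n → Alt n k) (z : Model n) : Alt n (k + 1) :=
  ContinuousAlternatingMap.alternatizeUncurryFin (wirtingerBar F z)

variable {M : Type*} [TopologicalSpace M] [ChartedSpace (Model n) M]

/-- The operator `∂` on forms on a complex manifold, computed in holomorphic charts. -/
def del (α : DForm n M k) : DForm n M (k + 1) :=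
  fun x => delModel (inChart α x) (chartAt (Model n) x x)

/-- The operator `∂̄` on forms on a complex manifold, computed in holomorphic charts. -/
def delbar (α : DForm n M k) : DForm n M (k + 1) :=
  fun x => delbarModel (inChart α x) (chartAt (Model n) x x)

/-- `α` is a form of type `(p, q)`, `p + q = k`: at every point
`α(c v₁, …, c v_k) = c^p c̄^q α(v₁, …, v_k)` for all complex numbers `c`. -/
def HasType (p q : ℕ) (α : DForm n M k) : Prop :=
  p + q = k ∧ ∀ (x : M) (c : ℂ) (v : Fin k → Model n),
    α x (fun j => c • v j) = c ^ p * (starRingEnd ℂ c) ^ q * α x v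

/-- The projection of a two-form to its `(1,1)`-part, `φ ↦ (φ + φ(J·, J·)) / 2`. (The map
`φ ↦ φ(J·, J·)` is `1` on `(1,1)`-forms and `-1` on `(2,0)`-forms and `(0,2)`-forms.) -/
def part11 (φ : DForm n M 2) : DForm n M 2 :=
  fun x => (1 / 2 : ℂ) • (φ x + (φ x).compContinuousLinearMap (mulI n))

/-- A real form: all its values on (real) tangent vectors are real. -/
def IsReal (α : DForm n M k) : Prop :=
  ∀ (x : M) (v : Fin k → Model n), (α x v).im = 0

end Dolbeault

/-! ### Powers of two-forms -/

section Powers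

variable {n : ℕ}

theorem alt2_add_left (φ : Alt n 2) (x y w : Model n) :
    φ ![x + y, w] = φ ![x, w] + φ ![y, w] := by
  have h := φ.map_update_add ![x, w] 0 x y
  have e (a : Model n) : Function.update ![x, w] 0 a = ![a, w] := by
    ext j : 1; fin_cases j <;> rfl
  rwa [e, e, e] at h

theorem alt2_add_right (φ : Alt n 2) (w x y : Model n) :
    φ ![w, x + y] = φ ![w, x] + φ ![w, y] := by
  have h := φ.map_update_add ![w, x] 1 x y
  have e (a : Model n) : Function.update ![w, x] 1 a = ![w, a] := by
    ext j : 1; fin_cases j <;> rfl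
  rwa [e, e, e] at h

theorem alt2_smul_left (φ : Alt n 2) (c : ℝ) (x w : Model n) :
    φ ![c • x, w] = c • φ ![x, w] := by
  have h := φ.map_update_smul ![x, w] 0 c x
  have e (a : Model n) : Function.update ![x, w] 0 a = ![a, w] := by
    ext j : 1; fin_cases j <;> rfl
  rwa [e, e] at h

theorem alt2_smul_right (φ : Alt n 2) (c : ℝ) (w x : Model n) :
    φ ![w, c • x] = c • φ ![w, x] := by
  have h := φ.map_update_smul ![w, x] 1 c x
  have e (a : Model n) : Function.update ![w, x] 1 a = ![w, a] := by
    ext j : 1; fin_cases j <;> rfl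
  rwa [e, e] at h

/-- The factors of `φ ⊗ ⋯ ⊗ φ` that do not involve the `t`-th vector. -/
theorem tensorPow_aux (φ : Alt n 2) {m t : ℕ} (v : Fin (2 * m) → Model n) (ht : t < 2 * m)
    (x y : Model n) :
    ∏ i ∈ Finset.univ.erase (⟨t / 2, by omega⟩ : Fin m),
        φ ![Function.update v ⟨t, ht⟩ x ⟨2 * i, by omega⟩,
          Function.update v ⟨t, ht⟩ x ⟨2 * i + 1, by omega⟩] =
      ∏ i ∈ Finset.univ.erase (⟨t / 2, by omega⟩ : Fin m),
        φ ![Function.update v ⟨t, ht⟩ y ⟨2 * i, by omega⟩,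
          Function.update v ⟨t, ht⟩ y ⟨2 * i + 1, by omega⟩] := by
  refine Finset.prod_congr rfl fun i hi => ?_
  have hne : (i : ℕ) ≠ t / 2 := fun h => (Finset.mem_erase.1 hi).1 (Fin.ext h)
  have h1 : 2 * (i : ℕ) ≠ t := by omega
  have h2 : 2 * (i : ℕ) + 1 ≠ t := by omega
  simp [h1, h2]

/-- `φ ⊗ ⋯ ⊗ φ` (`m` factors):
`(v₀, …, v_{2m-1}) ↦ φ(v₀, v₁) φ(v₂, v₃) ⋯ φ(v_{2m-2}, v_{2m-1})`. -/
def tensorPow (φ : Alt n 2) (m : ℕ) :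
    ContinuousMultilinearMap ℝ (fun _ : Fin (2 * m) => Model n) ℂ where
  toFun v := ∏ i : Fin m, φ ![v ⟨2 * i, by omega⟩, v ⟨2 * i + 1, by omega⟩]
  map_update_add' := by
    intro hdec v t x y
    have hd : hdec = instDecidableEqFin (2 * m) := Subsingleton.elim _ _
    subst hd
    obtain ⟨t, ht⟩ := t
    have hlt : t / 2 < m := by omega
    rw [← Finset.mul_prod_erase _ _ (Finset.mem_univ (⟨t / 2, hlt⟩ : Fin m)),
      ← Finset.mul_prod_erase _ _ (Finset.mem_univ (⟨t / 2, hlt⟩ : Fin m)),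
      ← Finset.mul_prod_erase _ _ (Finset.mem_univ (⟨t / 2, hlt⟩ : Fin m)),
      tensorPow_aux φ v ht x (x + y), tensorPow_aux φ v ht y (x + y), ← add_mul]
    congr 1
    rcases Nat.mod_two_eq_zero_or_one t with h | h
    · have h1 : 2 * (t / 2) = t := by omega
      have h2 : t + 1 ≠ t := by omega
      simpa [Function.update_apply, h1, h2] using
        alt2_add_left φ x y (v ⟨t + 1, by omega⟩)
    · have h1 : 2 * (t / 2) + 1 = t := by omega
      have h2 : 2 * (t / 2) ≠ t := by omega
      simpa [Function.update_apply, h1, h2] using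
        alt2_add_right φ (v ⟨2 * (t / 2), by omega⟩) x y
  map_update_smul' := by
    intro hdec v t c x
    have hd : hdec = instDecidableEqFin (2 * m) := Subsingleton.elim _ _
    subst hd
    obtain ⟨t, ht⟩ := t
    have hlt : t / 2 < m := by omega
    rw [← Finset.mul_prod_erase _ _ (Finset.mem_univ (⟨t / 2, hlt⟩ : Fin m)),
      ← Finset.mul_prod_erase _ _ (Finset.mem_univ (⟨t / 2, hlt⟩ : Fin m)),
      tensorPow_aux φ v ht x (c • x), ← smul_mul_assoc]
    congr 1
    rcases Nat.mod_two_eq_zero_or_one t with h | h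
    · have h1 : 2 * (t / 2) = t := by omega
      have h2 : t + 1 ≠ t := by omega
      simpa [Function.update_apply, h1, h2] using
        alt2_smul_left φ c x (v ⟨t + 1, by omega⟩)
    · have h1 : 2 * (t / 2) + 1 = t := by omega
      have h2 : 2 * (t / 2) ≠ t := by omega
      simpa [Function.update_apply, h1, h2] using
        alt2_smul_right φ c (v ⟨2 * (t / 2), by omega⟩) x
  cont := by
    refine continuous_finsetProd _ fun i _ => φ.cont.comp (continuous_pi fun j => ?_)
    fin_cases j
    · exact continuous_apply _
    · exact continuous_apply _

/-- The `m`-fold wedge power `φ ∧ ⋯ ∧ φ` of a two-form, with the convention in which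
`(dx ∧ dy)(∂x, ∂y) = 1`:
`φ^m (v₀, …) = 2⁻ᵐ ∑ σ, sign σ * φ(v_{σ 0}, v_{σ 1}) ⋯ φ(v_{σ (2m-2)}, v_{σ (2m-1)})`. -/
def wedgePow (φ : Alt n 2) (m : ℕ) : Alt n (2 * m) :=
  ((1 / 2 : ℂ) ^ m) • (tensorPow φ m).alternatization

end Powers

/-! ### Integration -/

section Integration

variable {n : ℕ} {M : Type*} [TopologicalSpace M] [ChartedSpace (Model n) M]

theorem exists_chart_partition (n : ℕ) (M : Type*) [TopologicalSpace M]
    [ChartedSpace (Model n) M] [CompactSpace M] [T2Space M] :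
    ∃ ρ : PartitionOfUnity M M Set.univ,
      ρ.IsSubordinate (fun c : M => (chartAt (Model n) c).source) :=
  PartitionOfUnity.exists_isSubordinate isClosed_univ _
    (fun c => (chartAt (Model n) c).open_source)
    (fun x _ => Set.mem_iUnion.2 ⟨x, mem_chart_source (Model n) x⟩)

/-- A partition of unity subordinate to the cover by chart domains; integrals do not depend on
its choice. Only finitely many of its functions are nonzero, as `M` is compact. -/
def chartPartition (n : ℕ) (M : Type*) [TopologicalSpace M] [ChartedSpace (Model n) M]
    [CompactSpace M] [T2Space M] : PartitionOfUnity M M Set.univ :=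
  (exists_chart_partition n M).choose

/-- The oriented real frame `∂/∂x₁, ∂/∂y₁, …, ∂/∂xₙ, ∂/∂yₙ` of `ℂⁿ`, where `z_j = x_j + i y_j`. -/
def realFrame (n : ℕ) (t : Fin (2 * n)) : Model n :=
  Pi.single ⟨t / 2, by omega⟩ (if (t : ℕ) % 2 = 0 then 1 else Complex.I)

/-- The integral of a form of top degree `2n` over `M` with its complex orientation. The measure
on `ℂⁿ` is Lebesgue measure `dx₁ dy₁ ⋯ dxₙ dyₙ`. -/
def integralForm [CompactSpace M] [T2Space M] (η : DForm n M (2 * n)) : ℂ :=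
  ∑ᶠ c : M, ∫ z in (chartAt (Model n) c).target,
    (chartPartition n M c ((chartAt (Model n) c).symm z) : ℂ) * inChart η c z (realFrame n)

end Integration

/-! ### Hermitian metrics -/

/-- The expression in the chart `chartAt c` of a field of real bilinear forms. -/
def bilinInChart {n : ℕ} {M : Type*} [TopologicalSpace M] [ChartedSpace (Model n) M]
    (b : M → Model n →L[ℝ] Model n →L[ℝ] ℝ) (c : M) (z : Model n) :
    Model n →L[ℝ] Model n →L[ℝ] ℝ :=
  (b ((chartAt (Model n) c).symm z)).bilinearComp (chartInvDeriv c z) (chartInvDeriv c z)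

/-- A smooth Hermitian metric on `M`: a smooth Riemannian metric with `g(Ju, Jv) = g(u, v)`. -/
structure HermitianMetric (n : ℕ) (M : Type*) [TopologicalSpace M]
    [ChartedSpace (Model n) M] where
  inner : M → Model n →L[ℝ] Model n →L[ℝ] ℝ
  symm : ∀ x u v, inner x u v = inner x v u
  pos : ∀ x u, u ≠ 0 → 0 < inner x u u
  compat : ∀ x u v, inner x (mulI n u) (mulI n v) = inner x u v
  smooth : ∀ c : M, ContDiffOn ℝ ∞ (bilinInChart inner c) (chartAt (Model n) c).target

/-- The matrix `b_{j k̄} = b(e_j, e_k) + i b(e_j, i e_k)` of a Hermitian bilinear form; it is the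
identity for the Euclidean metric of `ℂⁿ`. -/
def hermMatrix {n : ℕ} (b : Model n →L[ℝ] Model n →L[ℝ] ℝ) : Matrix (Fin n) (Fin n) ℂ :=
  fun j k => (b (Pi.single j 1) (Pi.single k 1) : ℂ) +
    Complex.I * (b (Pi.single j 1) (Pi.single k Complex.I) : ℂ)

/-- The component `α_{j̄} = α(∂/∂z̄_j)` of a one-form (extended complex linearly), where
`∂/∂z̄_j = (e_j + i J e_j) / 2`. -/
def compBar {n : ℕ} (α : Alt n 1) (j : Fin n) : ℂ :=
  (1 / 2) * (α ![Pi.single j 1] + Complex.I * α ![Pi.single j Complex.I])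

/-- The component `α_j = α(∂/∂z_j)` of a one-form (extended complex linearly), where
`∂/∂z_j = (e_j - i J e_j) / 2`. -/
def compHol {n : ℕ} (α : Alt n 1) (j : Fin n) : ℂ :=
  (1 / 2) * (α ![Pi.single j 1] - Complex.I * α ![Pi.single j Complex.I])

/-- The component `φ_{j k̄} = φ(∂/∂z_j, ∂/∂z̄_k)` of a two-form (extended complex bilinearly). -/
def compMixed {n : ℕ} (φ : Alt n 2) (j k : Fin n) : ℂ :=
  (1 / 4) * (φ ![Pi.single j 1, Pi.single k 1]
    + Complex.I * φ ![Pi.single j 1, Pi.single k Complex.I]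
    - Complex.I * φ ![Pi.single j Complex.I, Pi.single k 1]
    + φ ![Pi.single j Complex.I, Pi.single k Complex.I])

namespace HermitianMetric

variable {n : ℕ} {M : Type*} [TopologicalSpace M] [ChartedSpace (Model n) M]
  (g : HermitianMetric n M)

/-- The Kähler form `ω(u, v) = g(Ju, v)`; in holomorphic coordinates
`ω = (i/2) ∑ g_{j k̄} dz_j ∧ dz̄_k`. -/
def kahlerForm : DForm n M 2 := fun x =>
  { toFun := fun v => ((g.inner x (mulI n (v 0)) (v 1) : ℝ) : ℂ)
    map_update_add' := by
      intro _ v t a b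
      fin_cases t <;> simp
    map_update_smul' := by
      intro _ v t a b
      fin_cases t <;> simp
    map_eq_zero_of_eq' := by
      intro v i j hv hij
      have h01 : v 0 = v 1 := by
        fin_cases i <;> fin_cases j <;> simp_all
      have hJ : mulI n (mulI n (v 1)) = -(v 1) := by
        ext t
        simp [mulI, ← mul_assoc]
      have h1 := g.compat x (mulI n (v 1)) (v 1)
      rw [hJ, g.symm x _ (mulI n (v 1))] at h1
      simp only [map_neg] at h1
      have h2 : g.inner x (mulI n (v 1)) (v 1) = 0 := by linarith
      simp [h01, h2]
    cont := by
      have h : Continuous fun v : Fin 2 → Model n => g.inner x (mulI n (v 0)) (v 1) :=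
        (((g.inner x).continuous.comp ((mulI n).continuous.comp (continuous_apply 0))).clm_apply
          (continuous_apply 1))
      exact Complex.continuous_ofReal.comp h }

/-- The matrix `g_{j k̄}` in the chart `chartAt c`. -/
def matrixInChart (c : M) (z : Model n) : Matrix (Fin n) (Fin n) ℂ :=
  hermMatrix (bilinInChart g.inner c z)

/-- The matrix `g_{j k̄}` at `x` in the preferred coordinates at `x`. -/
def matrixAt (x : M) : Matrix (Fin n) (Fin n) ℂ := hermMatrix (g.inner x)

/-- The function `log det g` in the chart `chartAt c`, as a form of degree `0`. -/
def logDet (c : M) (z : Model n) : Alt n 0 :=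
  ContinuousAlternatingMap.constOfIsEmpty ℝ (Model n) (Fin 0)
    ((Real.log (g.matrixInChart c z).det.re : ℝ) : ℂ)

/-- The globally defined two-form `∂∂̄ log det g`, where `det g` is taken in local holomorphic
coordinates. -/
def deldelbarLogDet : DForm n M 2 := fun x =>
  delModel (delbarModel (g.logDet x)) (chartAt (Model n) x x)

/-- The pairing `g^{k̄ l} α_{k̄} conj(β_{l̄})` of `(0,1)`-forms at a point. -/
def pair01 (x : M) (α β : Alt n 1) : ℂ :=
  ∑ k, ∑ l, (g.matrixAt x)⁻¹ k l * compBar α k * starRingEnd ℂ (compBar β l)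

/-- The pairing `g^{i j̄} α_i conj(β_j)` of `(1,0)`-forms at a point. -/
def pair10 (x : M) (α β : Alt n 1) : ℂ :=
  ∑ i, ∑ j, (g.matrixAt x)⁻¹ j i * compHol α i * starRingEnd ℂ (compHol β j)

/-- The pairing `g^{ī j} g^{k̄ l} φ_{j k̄} conj(ψ_{i l̄})` of `(1,1)`-forms at a point. -/
def pair11 (x : M) (φ ψ : Alt n 2) : ℂ :=
  ∑ i, ∑ j, ∑ k, ∑ l, (g.matrixAt x)⁻¹ i j * (g.matrixAt x)⁻¹ k l *
    compMixed φ j k * starRingEnd ℂ (compMixed ψ i l)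

variable [CompactSpace M] [T2Space M]

/-- The integral `∫_M f dV_g` with respect to the Riemannian volume, which in holomorphic
coordinates is `det(g_{j k̄}) dx₁ dy₁ ⋯ dxₙ dyₙ`. -/
def integral (f : M → ℂ) : ℂ :=
  ∑ᶠ c : M, ∫ z in (chartAt (Model n) c).target,
    (chartPartition n M c ((chartAt (Model n) c).symm z) : ℂ) *
      (f ((chartAt (Model n) c).symm z) * (g.matrixInChart c z).det)

/-- `τ = ∂*φ` for a `(1,1)`-form `φ`: the value at `φ` of the `L²`-adjoint of
`∂ : Λ^{0,1} → Λ^{1,1}`. -/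
def IsDelStar (φ : DForm n M 2) (τ : DForm n M 1) : Prop :=
  IsSmooth τ ∧ HasType 0 1 τ ∧ ∀ α : DForm n M 1, IsSmooth α → HasType 0 1 α →
    g.integral (fun x => g.pair11 x (φ x) (del α x)) = g.integral (fun x => g.pair01 x (τ x) (α x))

/-- `σ = ∂̄*φ` for a `(1,1)`-form `φ`: the value at `φ` of the `L²`-adjoint of
`∂̄ : Λ^{1,0} → Λ^{1,1}`. -/
def IsDelbarStar (φ : DForm n M 2) (σ : DForm n M 1) : Prop :=
  IsSmooth σ ∧ HasType 1 0 σ ∧ ∀ α : DForm n M 1, IsSmooth α → HasType 1 0 α →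
    g.integral (fun x => g.pair11 x (φ x) (delbar α x)) =
      g.integral (fun x => g.pair10 x (σ x) (α x))

open scoped Classical in
/-- `∂*φ`. On a compact complex manifold it exists, and is unique, for every smooth
`(1,1)`-form `φ`. -/
def delStar (φ : DForm n M 2) : DForm n M 1 :=
  if h : ∃ τ, g.IsDelStar φ τ then h.choose else 0

open scoped Classical in
/-- `∂̄*φ`. On a compact complex manifold it exists, and is unique, for every smooth
`(1,1)`-form `φ`. -/
def delbarStar (φ : DForm n M 2) : DForm n M 1 :=
  if h : ∃ σ, g.IsDelbarStar φ σ then h.choose else 0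

/-- The operator `Φ(ω) = - ∂∂*ω - ∂̄∂̄*ω - (i/2) ∂∂̄ log det g`. -/
def Phi : DForm n M 2 :=
  -del (g.delStar g.kahlerForm) - delbar (g.delbarStar g.kahlerForm)
    - (Complex.I / 2) • g.deldelbarLogDet

/-- `g` is pluriclosed: `∂∂̄ω = 0`. -/
def IsPluriclosed : Prop := del (delbar g.kahlerForm) = 0

/-- `g` is a static metric with constant `lam`: it is pluriclosed, `Φ(ω) = lam ω`, and it has
volume one. -/
structure IsStatic (lam : ℝ) : Prop where
  pluriclosed : g.IsPluriclosed
  eqn : g.Phi = (lam : ℂ) • g.kahlerForm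
  volume : g.integral (fun _ => 1) = 1

/-- The form `ω̃ = ω - lam⁻¹ (∂̄∂*ω + ∂∂̄*ω)`. -/
def tildeForm (lam : ℝ) : DForm n M 2 :=
  g.kahlerForm - ((lam : ℂ)⁻¹) •
    (delbar (g.delStar g.kahlerForm) + del (g.delbarStar g.kahlerForm))

end HermitianMetric

/-- A Hermitian-symplectic structure: a smooth real closed two-form whose `(1,1)`-part is positive
definite, i.e. `φ^{(1,1)}(u, Ju) > 0` for `u ≠ 0`. -/
structure IsHermitianSymplectic {n : ℕ} {M : Type*} [TopologicalSpace M]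
    [ChartedSpace (Model n) M] (φ : DForm n M 2) : Prop where
  smooth : IsSmooth φ
  real : IsReal φ
  closed : extD φ = 0
  pos : ∀ (x : M) (u : Model n), u ≠ 0 → 0 < (part11 φ x ![u, mulI n u]).re

/-- A Hermitian-symplectic manifold: it carries a Hermitian-symplectic structure. -/
def HermitianSymplecticManifold (n : ℕ) (M : Type*) [TopologicalSpace M]
    [ChartedSpace (Model n) M] : Prop :=
  ∃ φ : DForm n M 2, IsHermitianSymplectic φ

end HermGeom

end

/-! Put τ = ∂*ω and σ = ∂̄*ω. Locally let L = log det g and G = τ + σ + (i/2) ∂̄L. Since ∂̄∂̄L = 0,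
dG = ∂τ + ∂̄τ + ∂σ + ∂̄σ + (i/2) ∂∂̄L, and the static equation turns this into -λω + ∂̄τ + ∂σ = -λ
ω̃. Hence ω̃ has the local primitive -λ⁻¹G and is closed (`extD_kahlerForm_sub`). In a holomorphic
chart L is a function; under a change of chart it gains log |det|² of the Jacobian, which ∂∂̄ kills,
so ∂∂̄L is a global form with the same expression in each chart (`inChart_deldelbarLogDet`).

As τ has type (0,1) and σ type (1,0), ∂̄τ and ∂σ have types (0,2) and (2,0), so the (1,1)-part of ω̃
is ω (`part11_kahlerForm_sub`). Reality follows from σ = conj τ (`delbarStar_kahlerForm`):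
conjugating the identity that defines ∂*ω gives the one that defines ∂̄*ω, and adjoints are unique
because the L² product is definite.

For the top power, ω̃(u, Ju) = g(u, u) > 0, so ω̃ tames J in every tangent space. A taming form is
nondegenerate, and so is each form on the segment joining it to the standard symplectic form. On
that segment the top power never vanishes on the oriented frame and starts positive, hence it ends
positive (`wedgePow_realFrame_pos`). A partition of unity then gives a positive integral
(`chartIntegral_pos`).

The operators ∂ and ∂̄ are treated together as `twistedD c` with c = -i and c = i. -/

noncomputable section

namespace HermGeom

section Forms

open ContinuousAlternatingMap

/-! ### Calculus of ∂ and ∂̄ on ℂⁿ -/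

section ModelCalculus

variable {n k : ℕ} {V : Type*} [NormedAddCommGroup V] [NormedSpace ℂ V]

theorem two_le_infty : (2 : WithTop ℕ∞) ≤ ∞ := WithTop.coe_le_coe.2 le_top

/-- The projection `A ↦ (A + c A ∘ J) / 2` of real linear maps; for `c = ∓ i` it is the projection
to the complex linear, respectively conjugate linear, part. -/
def halfProj (n : ℕ) (V : Type*) [NormedAddCommGroup V] [NormedSpace ℂ V] (c : ℂ) :
    (Model n →L[ℝ] V) →L[ℝ] (Model n →L[ℝ] V) :=
  (1 / 2 : ℂ) • (ContinuousLinearMap.id ℝ _ + c • (mulI n).precomp V)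

@[simp]
theorem halfProj_apply (c : ℂ) (A : Model n →L[ℝ] V) (u : Model n) :
    halfProj n V c A u = (1 / 2 : ℂ) • (A u + c • A (mulI n u)) := rfl

@[simp]
theorem mulI_apply (u : Model n) : mulI n u = Complex.I • u := rfl

/-- The common generalization of `∂` (for `c = -i`), `∂̄` (for `c = i`) on `ℂⁿ`. -/
def twistedD (c : ℂ) (F : Model n → Alt n k) (z : Model n) : Alt n (k + 1) :=
  alternatizeUncurryFin (halfProj n _ c (fderiv ℝ F z))

theorem delModel_eq : delModel (n := n) (k := k) = twistedD (-Complex.I) := by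
  funext F z
  unfold delModel twistedD
  congr 1
  ext u : 1
  simp [wirtinger, sub_eq_add_neg]

theorem delbarModel_eq : delbarModel (n := n) (k := k) = twistedD Complex.I := by
  funext F z
  unfold delbarModel twistedD
  congr 1

theorem delModel_add_delbarModel (F : Model n → Alt n k) (z : Model n) :
    delModel F z + delbarModel F z = extDeriv F z := by
  rw [delModel_eq, delbarModel_eq, twistedD, twistedD, extDeriv, ← alternatizeUncurryFin_add]
  congr 1
  ext u : 1
  simp only [_root_.add_apply, halfProj_apply]
  module

theorem twistedD_congr {c : ℂ} {F G : Model n → Alt n k} {z : Model n} (h : F =ᶠ[𝓝 z] G) :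
    twistedD c F z = twistedD c G z := by
  rw [twistedD, twistedD, h.fderiv_eq]

theorem twistedD_add {c : ℂ} {F G : Model n → Alt n k} {z : Model n}
    (hF : DifferentiableAt ℝ F z) (hG : DifferentiableAt ℝ G z) :
    twistedD c (fun z => F z + G z) z = twistedD c F z + twistedD c G z := by
  rw [twistedD, fderiv_fun_add hF hG, map_add, alternatizeUncurryFin_add, twistedD, twistedD]

theorem twistedD_contDiffOn {c : ℂ} {F : Model n → Alt n k} {U : Set (Model n)} (hU : IsOpen U)
    (hF : ContDiffOn ℝ ∞ F U) : ContDiffOn ℝ ∞ (twistedD c F) U := by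
  have h : ContDiffOn ℝ ∞ (fderiv ℝ F) U := hF.fderiv_of_isOpen hU (by simp)
  exact ((alternatizeUncurryFinCLM ℝ (Model n) ℂ).comp (halfProj n _ c)).contDiff.comp_contDiffOn h

/-- Twisting both arguments of the symmetric second derivative by the same `c` leaves it symmetric,
and alternation kills a symmetric expression. This covers ∂∂ = 0 and ∂̄∂̄ = 0 at once. -/
theorem twistedD_twistedD {c : ℂ} (F : Model n → Alt n k) {z : Model n}
    (hF : ContDiffAt ℝ ∞ F z) : twistedD c (twistedD c F) z = 0 := by
  have h1 : DifferentiableAt ℝ (fderiv ℝ F) z :=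
    (hF.fderiv_right (m := 1) (by simpa [one_add_one_eq_two] using two_le_infty)).differentiableAt (by simp)
  have h2 : HasFDerivAt (twistedD c F)
      ((alternatizeUncurryFinCLM ℝ (Model n) ℂ).comp
        ((halfProj n _ c).comp (fderiv ℝ (fderiv ℝ F) z))) z :=
    ((alternatizeUncurryFinCLM ℝ (Model n) ℂ).comp
      (halfProj n (Alt n k) c)).hasFDerivAt.comp z h1.hasFDerivAt
  have hs : IsSymmSndFDerivAt ℝ F z := hF.isSymmSndFDerivAt (by simpa using two_le_infty)
  have h3 : halfProj n _ c ((alternatizeUncurryFinCLM ℝ (Model n) ℂ).comp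
        ((halfProj n _ c).comp (fderiv ℝ (fderiv ℝ F) z))) =
      (alternatizeUncurryFinCLM ℝ (Model n) ℂ).comp
        (halfProj n _ c ((halfProj n _ c).comp (fderiv ℝ (fderiv ℝ F) z))) := by
    ext u : 1
    simp only [halfProj_apply, ContinuousLinearMap.comp_apply, alternatizeUncurryFinCLM_apply,
      alternatizeUncurryFin_smul, alternatizeUncurryFin_add]
  rw [twistedD, h2.fderiv, h3]
  refine alternatizeUncurryFin_alternatizeUncurryFinCLM_comp_of_symmetric fun u v => ?_
  simp only [halfProj_apply, ContinuousLinearMap.comp_apply, _root_.smul_apply,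
    _root_.add_apply]
  rw [hs.eq u v, hs.eq (mulI n u) v, hs.eq u (mulI n v), hs.eq (mulI n u) (mulI n v)]
  module

/-- The operators `∂` and `∂̄` commute with the pullback by a holomorphic map. -/
theorem twistedD_pullback {c : ℂ} {F : Model n → Alt n k} {f : Model n → Model n} {z : Model n}
    (hF : DifferentiableAt ℝ F (f z)) (hf : ContDiffAt ℂ ∞ f z) :
    twistedD c (fun z => (F (f z)).compContinuousLinearMap
        ((fderiv ℂ f z).restrictScalars ℝ)) z =
      (twistedD c F (f z)).compContinuousLinearMap ((fderiv ℂ f z).restrictScalars ℝ) := by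
  have hfd : DifferentiableAt ℂ f z := hf.differentiableAt (by simp)
  have hfR : HasFDerivAt f ((fderiv ℂ f z).restrictScalars ℝ) z :=
    hfd.hasFDerivAt.restrictScalars ℝ
  have h2 : DifferentiableAt ℂ (fderiv ℂ f) z :=
    (hf.fderiv_right (m := 1) (by simpa [one_add_one_eq_two] using two_le_infty)).differentiableAt (by simp)
  have h2s : IsSymmSndFDerivAt ℂ f z := hf.isSymmSndFDerivAt (by simpa using two_le_infty)
  let R : (Model n →L[ℂ] Model n) →L[ℝ] (Model n →L[ℝ] Model n) :=
    ContinuousLinearMap.restrictScalarsL ℂ (Model n) (Model n) ℝ ℝ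
  have h2R : HasFDerivAt (fun z => (fderiv ℂ f z).restrictScalars ℝ)
      (R.comp ((fderiv ℂ (fderiv ℂ f) z).restrictScalars ℝ)) z :=
    R.hasFDerivAt.comp z (h2.hasFDerivAt.restrictScalars ℝ)
  have hmain := (hF.hasFDerivAt.comp z hfR).continuousAlternatingMapCompContinuousLinearMap h2R
  have hsplit : ∀ A B : Model n →L[ℝ] Alt n k, halfProj n _ c (A + B) =
      halfProj n _ c A + halfProj n _ c B := map_add _
  simp only [Function.comp_apply] at hmain
  rw [twistedD, hmain.fderiv, hsplit, alternatizeUncurryFin_add]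
  set Q := (F (f z)).fderivCompContinuousLinearMap ((fderiv ℂ f z).restrictScalars ℝ)
  set S := R.comp ((fderiv ℂ (fderiv ℂ f) z).restrictScalars ℝ)
  have hS : ∀ u v, S u v = fderiv ℂ (fderiv ℂ f) z u v := fun _ _ => rfl
  -- The term in which the Jacobian of `f` is differentiated. The second derivative of `f` is
  -- symmetric and complex bilinear, so both it and its composition with J in one slot are
  -- symmetric, and alternation kills each.
  have hzero : alternatizeUncurryFin (halfProj n _ c (Q.comp S)) = 0 := by
    have e : halfProj n _ c (Q.comp S) = (1 / 2 : ℂ) • (Q.comp S + c • Q.comp (S.comp (mulI n))) :=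
      rfl
    rw [e, alternatizeUncurryFin_smul, alternatizeUncurryFin_add, alternatizeUncurryFin_smul,
      alternatizeUncurryFin_fderivCompContinuousLinearMap_eq_zero,
      alternatizeUncurryFin_fderivCompContinuousLinearMap_eq_zero]
    · simp
    · intro u v
      simp only [ContinuousLinearMap.comp_apply, hS, mulI_apply, map_smul,
        _root_.smul_apply]
      rw [h2s.eq]
    · intro u v
      rw [hS, hS, h2s.eq]
  rw [hzero, add_zero]
  -- The chain rule term remains; the complex linear Jacobian commutes with J, so the projection
  -- passes through it.
  ext v
  simp only [twistedD, compContinuousLinearMap_apply, alternatizeUncurryFin_apply]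
  refine Finset.sum_congr rfl fun i _ => ?_
  congr 1
  simp +unfoldPartialApp [Fin.removeNth, Function.comp_def]

/-- If `F` is homogeneous under `J`, so is its derivative. -/
theorem twistedD_comp_mulI {c a : ℂ} (hc : c * c = -1) {F : Model n → Alt n k} {z : Model n}
    (hF : DifferentiableAt ℝ F z)
    (h : ∀ᶠ w in 𝓝 z, (F w).compContinuousLinearMap (mulI n) = a • F w) :
    (twistedD c F z).compContinuousLinearMap (mulI n) = (-c * a) • twistedD c F z := by
  let L : Alt n k →L[ℝ] Alt n k := compContinuousLinearMapCLM (mulI n)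
  have h1 : HasFDerivAt (fun w => (F w).compContinuousLinearMap (mulI n))
      (L.comp (fderiv ℝ F z)) z := L.hasFDerivAt.comp z hF.hasFDerivAt
  have h2 : L.comp (fderiv ℝ F z) = a • fderiv ℝ F z :=
    (h1.congr_of_eventuallyEq (Filter.EventuallyEq.symm h)).unique (hF.hasFDerivAt.const_smul a)
  have h3 (u : Model n) (v : Fin k → Model n) :
      fderiv ℝ F z u (fun j => mulI n (v j)) = a * fderiv ℝ F z u v := by
    have := congrArg (fun A : Model n →L[ℝ] Alt n k => A u v) h2
    exact this
  have hJ (u : Model n) : mulI n (mulI n u) = -u := by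
    simp [smul_smul]
  ext v
  simp only [twistedD, compContinuousLinearMap_apply, ContinuousAlternatingMap.smul_apply,
    alternatizeUncurryFin_apply, Finset.smul_sum]
  refine Finset.sum_congr rfl fun i _ => ?_
  have e : i.removeNth (⇑(mulI n) ∘ v) = fun j => mulI n (i.removeNth v j) := rfl
  rw [smul_comm (-c * a)]
  congr 1
  rw [e]
  simp only [halfProj_apply, Function.comp_apply, ContinuousAlternatingMap.smul_apply,
    ContinuousAlternatingMap.add_apply, h3, hJ, map_neg, ContinuousAlternatingMap.neg_apply,
    smul_eq_mul]
  -- Since c² = -1, the projected derivative satisfies P(Ju) = -c P(u); the remaining slots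
  -- contribute `a`.
  linear_combination (a / 2 * fderiv ℝ F z (mulI n (v i)) (i.removeNth v)) * hc

/-- Complex conjugation of forms, as a real linear map. -/
def conjForm (n k : ℕ) : Alt n k →L[ℝ] Alt n k :=
  ContinuousLinearMap.compContinuousAlternatingMapCLM ℝ (Model n) ℂ ℂ (Fin k)
    (Complex.conjCLE : ℂ →L[ℝ] ℂ)

@[simp]
theorem conjForm_apply (α : Alt n k) (v : Fin k → Model n) :
    conjForm n k α v = starRingEnd ℂ (α v) := rfl

/-- Conjugation commutes with the real derivative and conjugates the coefficient `c`; for c = ±i it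
exchanges ∂ and ∂̄. -/
theorem twistedD_conjForm {c : ℂ} {F : Model n → Alt n k} {z : Model n}
    (hF : DifferentiableAt ℝ F z) :
    twistedD c (fun w => conjForm n k (F w)) z =
      conjForm n (k + 1) (twistedD (starRingEnd ℂ c) F z) := by
  have h1 : HasFDerivAt (fun w => conjForm n k (F w)) ((conjForm n k).comp (fderiv ℝ F z)) z :=
    (conjForm n k).hasFDerivAt.comp z hF.hasFDerivAt
  rw [twistedD, h1.fderiv]
  ext v
  simp [twistedD, alternatizeUncurryFin_apply, map_ofNat]

theorem twistedD_smul {c : ℂ} (a : ℂ) {F : Model n → Alt n k} {z : Model n}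
    (hF : DifferentiableAt ℝ F z) : twistedD c (fun w => a • F w) z = a • twistedD c F z := by
  rw [twistedD, fderiv_fun_const_smul hF, twistedD, ← alternatizeUncurryFin_smul]
  congr 1
  ext u v
  simp
  ring

end ModelCalculus

/-! ### Pluriharmonicity of log |h|² -/

section Pluriharmonic

variable {n k : ℕ}

/-- The Cauchy–Riemann equations: on a complex linear map the projection is multiplication by (1 +
i·i)/2 = 0. -/
theorem twistedD_I_of_differentiableAt {K : Model n → Alt n k} {z : Model n}
    (hK : DifferentiableAt ℂ K z) : twistedD Complex.I K z = 0 := by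
  have h : halfProj n _ Complex.I (fderiv ℝ K z) = 0 := by
    ext u : 1
    rw [(hK.hasFDerivAt.restrictScalars ℝ).fderiv]
    simp only [halfProj_apply, ContinuousLinearMap.coe_restrictScalars', mulI_apply, map_smul,
      smul_smul, Complex.I_mul_I, _root_.zero_apply]
    module
  rw [twistedD, h]
  exact map_zero (alternatizeUncurryFinCLM ℝ (Model n) ℂ)

theorem twistedD_neg_I_add_twistedD_I (F : Model n → Alt n k) (z : Model n) :
    twistedD (-Complex.I) F z + twistedD Complex.I F z = extDeriv F z := by
  rw [← delModel_eq, ← delbarModel_eq, delModel_add_delbarModel]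

theorem eventually_differentiableAt {V : Type*} [NormedAddCommGroup V] [NormedSpace ℂ V]
    {F : Model n → V} {z : Model n} (hF : ContDiffAt ℂ ∞ F z) :
    ∀ᶠ w in 𝓝 z, DifferentiableAt ℂ F w :=
  -- Smoothness of infinite order at a point need not persist on one neighbourhood; finite order
  -- does, so order two is used.
  ((hF.of_le two_le_infty).eventually (by simp)).mono fun _ hw => hw.differentiableAt (by simp)

/-- The real part of a holomorphic function is annihilated by `∂∂̄`. -/
theorem del_delbar_add_conjForm {K : Model n → Alt n k} {z : Model n}
    (hK : ContDiffAt ℂ ∞ K z) :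
    twistedD (-Complex.I) (twistedD Complex.I (fun w => K w + conjForm n k (K w))) z = 0 := by
  have hKR : ContDiffAt ℝ ∞ K z := hK.restrict_scalars ℝ
  have hev : ∀ᶠ w in 𝓝 z, DifferentiableAt ℂ K w :=
    eventually_differentiableAt hK
  -- Since ∂̄K = 0, only ∂̄ of the conjugate survives, and it equals the conjugate of ∂K.
  have h1 : twistedD Complex.I (fun w => K w + conjForm n k (K w)) =ᶠ[𝓝 z]
      fun w => conjForm n (k + 1) (twistedD (-Complex.I) K w) := by
    filter_upwards [hev] with w hw
    have hwR : DifferentiableAt ℝ K w := hw.restrictScalars ℝ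
    rw [twistedD_add (G := fun w => conjForm n k (K w)) hwR
        ((conjForm n k).differentiableAt.comp w hwR),
      twistedD_I_of_differentiableAt hw, twistedD_conjForm hwR, zero_add, Complex.conj_I]
  have h2 : twistedD (-Complex.I) K =ᶠ[𝓝 z] extDeriv K := by
    filter_upwards [hev] with w hw
    rw [← twistedD_neg_I_add_twistedD_I, twistedD_I_of_differentiableAt hw, add_zero]
  have hd : DifferentiableAt ℝ (twistedD (-Complex.I) K) z := by
    have : DifferentiableAt ℝ (fderiv ℝ K) z :=
      (hKR.fderiv_right (m := 1) (by simpa [one_add_one_eq_two] using two_le_infty)).differentiableAt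
        (by simp)
    exact ((alternatizeUncurryFinCLM ℝ (Model n) ℂ).comp
      (halfProj n _ _)).differentiableAt.comp z this
  rw [twistedD_congr h1, twistedD_conjForm hd]
  -- It remains that ∂̄∂K = 0: as ∂∂K = 0 and ∂K = dK near `z`, it equals d(dK).
  have h3 := twistedD_neg_I_add_twistedD_I (twistedD (-Complex.I) K) z
  rw [twistedD_twistedD K hKR, zero_add, h2.extDeriv_eq,
    extDeriv_extDeriv_apply hKR (by simpa using two_le_infty)] at h3
  simp [h3]

/-- `∂∂̄ log |h|² = 0` for a holomorphic function `h` without zeros. -/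
theorem del_delbar_log_normSq {h : Model n → ℂ} {z : Model n} (hh : ContDiffAt ℂ ∞ h z)
    (hz : h z ≠ 0) :
    twistedD (-Complex.I) (twistedD Complex.I (fun w =>
      constOfIsEmpty ℝ (Model n) (Fin 0) ((Real.log (Complex.normSq (h w)) : ℝ) : ℂ))) z = 0 := by
  -- Dividing by `h z` keeps the argument of the logarithm near 1, inside the slit plane; the
  -- constant log |h z| makes κ + conj κ = log |h|².
  let κ : Model n → ℂ := fun w => Complex.log (h w / h z) + (Real.log ‖h z‖ : ℝ)
  have hκ : ContDiffAt ℂ ∞ κ z := by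
    refine ContDiffAt.add (ContDiffAt.comp z (Complex.contDiffAt_log ?_) (hh.div_const _))
      contDiffAt_const
    simp [hz]
  let E : ℂ →L[ℂ] Alt n 0 := LinearMap.toContinuousLinearMap
    { toFun := fun a => constOfIsEmpty ℝ (Model n) (Fin 0) a
      map_add' := fun _ _ => rfl
      map_smul' := fun _ _ => rfl }
  have hK : ContDiffAt ℂ ∞ (fun w => E (κ w)) z := E.contDiff.contDiffAt.comp z hκ
  rw [← del_delbar_add_conjForm hK]
  have hne : ∀ᶠ w in 𝓝 z, h w ≠ 0 := hh.continuousAt.eventually_ne hz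
  have hev : (fun w => constOfIsEmpty ℝ (Model n) (Fin 0)
      ((Real.log (Complex.normSq (h w)) : ℝ) : ℂ)) =ᶠ[𝓝 z]
      fun w => E (κ w) + conjForm n 0 (E (κ w)) := by
    filter_upwards [hne] with w hw
    ext v
    change ((Real.log (Complex.normSq (h w)) : ℝ) : ℂ) = κ w + starRingEnd ℂ (κ w)
    rw [Complex.add_conj]
    congr 1
    simp only [κ, Complex.add_re, Complex.log_re, Complex.ofReal_re, norm_div]
    rw [Real.log_div (norm_ne_zero_iff.2 hw) (norm_ne_zero_iff.2 hz), Complex.normSq_eq_norm_sq,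
      Real.log_pow]
    push_cast
    ring
  refine twistedD_congr ?_
  filter_upwards [hev.eventually_nhds] with w hw
  exact twistedD_congr hw

end Pluriharmonic

/-! ### Hermitian bilinear forms and their matrices -/

section HermitianMatrices

variable {n : ℕ}

/-- The sesquilinear form `b(u, v) + i b(u, iv)` of a Hermitian bilinear form. -/
def sesq (b : Model n →L[ℝ] Model n →L[ℝ] ℝ) (u v : Model n) : ℂ :=
  (b u v : ℂ) + Complex.I * (b u (mulI n v) : ℂ)

theorem hermMatrix_apply (b : Model n →L[ℝ] Model n →L[ℝ] ℝ) (j k : Fin n) :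
    hermMatrix b j k = sesq b (Pi.single j 1) (Pi.single k 1) := by
  simp [hermMatrix, sesq, ← Pi.single_smul]

theorem mulI_mulI (u : Model n) : mulI n (mulI n u) = -u := by
  simp [smul_smul]

theorem real_smul_add_mulI (c : ℂ) (u : Model n) : c • u = c.re • u + c.im • mulI n u := by
  ext j
  simp only [Pi.smul_apply, Pi.add_apply, mulI_apply, smul_eq_mul, Complex.real_smul]
  conv_lhs => rw [← Complex.re_add_im c]
  ring

variable {b : Model n →L[ℝ] Model n →L[ℝ] ℝ}

theorem compat_left (hb : ∀ u v, b (mulI n u) (mulI n v) = b u v) (u v : Model n) :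
    b (mulI n u) v = -b u (mulI n v) := by
  rw [← hb (mulI n u) v, mulI_mulI]
  simp

theorem sesq_add_left (u u' v : Model n) : sesq b (u + u') v = sesq b u v + sesq b u' v := by
  simp [sesq]
  ring

theorem sesq_add_right (u v v' : Model n) : sesq b u (v + v') = sesq b u v + sesq b u v' := by
  simp only [sesq, map_add]
  push_cast
  ring

theorem sesq_smul_left (hb : ∀ u v, b (mulI n u) (mulI n v) = b u v) (c : ℂ) (u v : Model n) :
    sesq b (c • u) v = c * sesq b u v := by
  rw [real_smul_add_mulI c]
  simp only [sesq, map_add, map_smul, _root_.add_apply, _root_.smul_apply, smul_eq_mul,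
    compat_left hb, mulI_mulI, map_neg]
  conv_rhs => rw [← Complex.re_add_im c]
  push_cast
  linear_combination (-(c.im : ℂ) * (b u (mulI n v) : ℂ)) * Complex.I_sq

theorem sesq_smul_right (c : ℂ) (u v : Model n) :
    sesq b u (c • v) = starRingEnd ℂ c * sesq b u v := by
  rw [real_smul_add_mulI c]
  simp only [sesq, map_add, map_smul, smul_eq_mul, mulI_mulI, map_neg]
  have : starRingEnd ℂ c = (c.re : ℂ) - c.im * Complex.I := by
    apply Complex.ext <;> simp
  rw [this]
  push_cast
  linear_combination ((c.im : ℂ) * (b u (mulI n v) : ℂ)) * Complex.I_sq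

theorem sesq_conj_symm (hb : ∀ u v, b (mulI n u) (mulI n v) = b u v)
    (hs : ∀ u v, b u v = b v u) (u v : Model n) :
    starRingEnd ℂ (sesq b u v) = sesq b v u := by
  have h : b v (mulI n u) = -b u (mulI n v) := by
    rw [hs v, compat_left hb]
  simp only [sesq, h, hs v u, map_add, map_mul, Complex.conj_ofReal, Complex.conj_I]
  push_cast
  ring

theorem sesq_self (hb : ∀ u v, b (mulI n u) (mulI n v) = b u v)
    (hs : ∀ u v, b u v = b v u) (u : Model n) : sesq b u u = (b u u : ℂ) := by
  have h : b u (mulI n u) = 0 := by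
    have h1 := compat_left hb u u
    rw [hs] at h1
    linarith
  simp only [sesq, h, Complex.ofReal_zero, mul_zero, add_zero]

theorem sesq_eq_sum (hb : ∀ u v, b (mulI n u) (mulI n v) = b u v) (u v : Model n) :
    sesq b u v = ∑ p, ∑ q, u p * hermMatrix b p q * starRingEnd ℂ (v q) := by
  have h0l (w : Model n) : sesq b 0 w = 0 := by simp [sesq]
  have h0r (w : Model n) : sesq b w 0 = 0 := by simp [sesq]
  have hl (s : Finset (Fin n)) (f : Fin n → Model n) (w : Model n) :
      sesq b (∑ p ∈ s, f p) w = ∑ p ∈ s, sesq b (f p) w := by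
    classical
    induction s using Finset.induction_on with
    | empty => simp [h0l]
    | insert a s ha ih => rw [Finset.sum_insert ha, Finset.sum_insert ha, sesq_add_left, ih]
  have hr (s : Finset (Fin n)) (f : Fin n → Model n) (w : Model n) :
      sesq b w (∑ p ∈ s, f p) = ∑ p ∈ s, sesq b w (f p) := by
    classical
    induction s using Finset.induction_on with
    | empty => simp [h0r]
    | insert a s ha ih => rw [Finset.sum_insert ha, Finset.sum_insert ha, sesq_add_right, ih]
  have e (w : Model n) : w = ∑ p, w p • (Pi.single p 1 : Model n) := by
    ext j
    simp [Finset.sum_apply, Pi.single_apply]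
  conv_lhs => rw [e u, e v, hl]
  refine Finset.sum_congr rfl fun p _ => ?_
  rw [hr]
  refine Finset.sum_congr rfl fun q _ => ?_
  rw [sesq_smul_left hb, sesq_smul_right, hermMatrix_apply]
  ring

/-- The matrix of a complex linear endomorphism of `ℂⁿ`. -/
def matrixOf (A : Model n →L[ℂ] Model n) : Matrix (Fin n) (Fin n) ℂ := fun p j => A (Pi.single j 1) p

theorem matrixOf_eq (A : Model n →L[ℂ] Model n) :
    matrixOf A = LinearMap.toMatrix' (A : Model n →ₗ[ℂ] Model n) := by
  ext p j
  simp [matrixOf, LinearMap.toMatrix'_apply]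

theorem hermMatrix_comp (hb : ∀ u v, b (mulI n u) (mulI n v) = b u v)
    (A : Model n →L[ℂ] Model n) :
    hermMatrix (b.bilinearComp (A.restrictScalars ℝ) (A.restrictScalars ℝ)) =
      (matrixOf A).transpose * hermMatrix b * (matrixOf A).map (starRingEnd ℂ) := by
  ext j k
  have h : hermMatrix (b.bilinearComp (A.restrictScalars ℝ) (A.restrictScalars ℝ)) j k =
      sesq b (A (Pi.single j 1)) (A (Pi.single k 1)) := by
    rw [hermMatrix_apply]
    simp [sesq]
  rw [h, sesq_eq_sum hb, Finset.sum_comm]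
  simp only [Matrix.mul_apply, Matrix.transpose_apply, Matrix.map_apply, matrixOf,
    Finset.sum_mul]

theorem hermMatrix_isHermitian (hb : ∀ u v, b (mulI n u) (mulI n v) = b u v)
    (hs : ∀ u v, b u v = b v u) : (hermMatrix b).IsHermitian := by
  ext j k
  rw [Matrix.conjTranspose_apply, hermMatrix_apply, hermMatrix_apply, ← sesq_conj_symm hb hs]
  exact star_star _

open scoped ComplexOrder in
theorem hermMatrix_posDef (hb : ∀ u v, b (mulI n u) (mulI n v) = b u v)
    (hs : ∀ u v, b u v = b v u) (hp : ∀ u, u ≠ 0 → 0 < b u u) : (hermMatrix b).PosDef := by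
  refine Matrix.PosDef.of_dotProduct_mulVec_pos (hermMatrix_isHermitian hb hs) fun x hx => ?_
  -- `sesq` is conjugate linear in its second slot, whereas x* H x is so in the left factor; hence
  -- the vector `star x`.
  have h : star x ⬝ᵥ (hermMatrix b).mulVec x = sesq b (star x) (star x) := by
    rw [sesq_eq_sum hb]
    simp [dotProduct, Matrix.mulVec, Finset.mul_sum, mul_assoc]
  rw [h, sesq_self hb hs]
  exact_mod_cast hp _ (by simpa using hx)

end HermitianMatrices

/-! ### Forms in holomorphic charts -/

section Charts

variable {n k : ℕ} {M : Type*} [TopologicalSpace M] [ChartedSpace (Model n) M]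

/-- The change of coordinates from `chartAt c` to `chartAt y`. -/
def coordChange (n : ℕ) {M : Type*} [TopologicalSpace M] [ChartedSpace (Model n) M] (c y : M)
    (z : Model n) : Model n :=
  chartAt (Model n) y ((chartAt (Model n) c).symm z)

theorem eventually_mem_target_source {c y : M} {z : Model n}
    (hz : z ∈ (chartAt (Model n) c).target)
    (hy : (chartAt (Model n) c).symm z ∈ (chartAt (Model n) y).source) :
    ∀ᶠ w in 𝓝 z, w ∈ (chartAt (Model n) c).target ∧
      (chartAt (Model n) c).symm w ∈ (chartAt (Model n) y).source :=
  ((chartAt (Model n) c).open_target.mem_nhds hz |> Filter.eventually_of_mem <| fun _ h => h).and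
    (((chartAt (Model n) c).continuousAt_symm hz).eventually
      ((chartAt (Model n) y).open_source.mem_nhds hy))

theorem coordChange_mem_target {c y : M} {z : Model n}
    (hy : (chartAt (Model n) c).symm z ∈ (chartAt (Model n) y).source) :
    coordChange n c y z ∈ (chartAt (Model n) y).target :=
  (chartAt (Model n) y).map_source hy

theorem symm_coordChange {c y : M} {z : Model n}
    (hy : (chartAt (Model n) c).symm z ∈ (chartAt (Model n) y).source) :
    (chartAt (Model n) y).symm (coordChange n c y z) = (chartAt (Model n) c).symm z :=
  (chartAt (Model n) y).left_inv hy

/-- The common generalization of `∂` (for `a = -i`) and `∂̄` (for `a = i`) on a manifold. -/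
def twistedDM (a : ℂ) (α : DForm n M k) : DForm n M (k + 1) :=
  fun x => twistedD a (inChart α x) (chartAt (Model n) x x)

theorem del_eq : del (n := n) (k := k) (M := M) = twistedDM (-Complex.I) := by
  funext α x
  rw [del, delModel_eq, twistedDM]

theorem delbar_eq : delbar (n := n) (k := k) (M := M) = twistedDM Complex.I := by
  funext α x
  rw [delbar, delbarModel_eq, twistedDM]

theorem IsSmooth.contDiffAt {α : DForm n M k} (hα : IsSmooth α) {c : M} {z : Model n}
    (hz : z ∈ (chartAt (Model n) c).target) : ContDiffAt ℝ ∞ (inChart α c) z :=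
  (hα c).contDiffAt ((chartAt (Model n) c).open_target.mem_nhds hz)

theorem IsSmooth.differentiableAt {α : DForm n M k} (hα : IsSmooth α) {c : M} {z : Model n}
    (hz : z ∈ (chartAt (Model n) c).target) : DifferentiableAt ℝ (inChart α c) z :=
  (hα.contDiffAt hz).differentiableAt (by simp)

variable [IsManifold 𝓘(ℂ, Model n) ω M]

theorem coordChange_contDiffAt {c y : M} {z : Model n}
    (hz : z ∈ (chartAt (Model n) c).target)
    (hy : (chartAt (Model n) c).symm z ∈ (chartAt (Model n) y).source) :
    ContDiffAt ℂ ∞ (coordChange n c y) z := by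
  have h1 := (contMDiffOn_chart_symm (I := 𝓘(ℂ, Model n)) (n := ω) (x := c)).contMDiffAt
    ((chartAt (Model n) c).open_target.mem_nhds hz)
  have h2 := (contMDiffOn_chart (I := 𝓘(ℂ, Model n)) (n := ω) (x := y)).contMDiffAt
    ((chartAt (Model n) y).open_source.mem_nhds hy)
  exact (h2.comp z h1).contDiffAt.of_le le_top

theorem mdifferentiableAt_chart_symm {c : M} {z : Model n}
    (hz : z ∈ (chartAt (Model n) c).target) :
    MDifferentiableAt 𝓘(ℂ, Model n) 𝓘(ℂ, Model n) (chartAt (Model n) c).symm z := by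
  have : IsManifold 𝓘(ℂ, Model n) 1 M := IsManifold.of_le (n := ω) le_top
  exact mdifferentiableAt_atlas_symm (chart_mem_atlas _ c) hz

theorem chartInvDerivC_comp {c y : M} {z : Model n}
    (hz : z ∈ (chartAt (Model n) c).target)
    (hy : (chartAt (Model n) c).symm z ∈ (chartAt (Model n) y).source) :
    chartInvDerivC c z =
      (chartInvDerivC y (coordChange n c y z)).comp (fderiv ℂ (coordChange n c y) z) := by
  have hev : (chartAt (Model n) c).symm =ᶠ[𝓝 z]
      (chartAt (Model n) y).symm ∘ coordChange n c y := by
    filter_upwards [eventually_mem_target_source hz hy] with w hw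
    exact (symm_coordChange hw.2).symm
  unfold chartInvDerivC
  rw [hev.mfderiv_eq, mfderiv_comp z (mdifferentiableAt_chart_symm (coordChange_mem_target hy))
    ((coordChange_contDiffAt hz hy).differentiableAt (by simp)).mdifferentiableAt, mfderiv_eq_fderiv]
  rfl

/-- The tangent space at `y` is identified with ℂⁿ by the preferred chart at `y`, so in that chart
the differential at `y` is the identity. -/
theorem chartInvDerivC_self (y : M) :
    chartInvDerivC y (chartAt (Model n) y y) = ContinuousLinearMap.id ℂ (Model n) := by
  have hy := mem_chart_target (Model n) y
  have hl := (chartAt (Model n) y).left_inv (mem_chart_source (Model n) y)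
  unfold chartInvDerivC
  rw [(mdifferentiableAt_chart_symm hy).mfderiv]
  simp only [writtenInExtChartAt, extChartAt, mfld_simps]
  rw [chartAt_self_eq]
  have hev : (chartAt (Model n) y ∘ (chartAt (Model n) y).symm) =ᶠ[𝓝 (chartAt (Model n) y y)] id :=
    Filter.eventually_of_mem ((chartAt (Model n) y).open_target.mem_nhds hy)
      fun w hw => (chartAt (Model n) y).right_inv hw
  rw [fderivWithin_univ]
  exact hev.fderiv_eq.trans fderiv_id

theorem chartInvDerivC_injective {c : M} {z : Model n} (hz : z ∈ (chartAt (Model n) c).target) :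
    Function.Injective (chartInvDerivC c z) := by
  have : IsManifold 𝓘(ℂ, Model n) 1 M := IsManifold.of_le (n := ω) le_top
  exact (mdifferentiable_chart (I := 𝓘(ℂ, Model n)) c).symm.mfderiv_injective hz

theorem inChart_eq_pullback (α : DForm n M k) {c y : M} {z : Model n}
    (hz : z ∈ (chartAt (Model n) c).target)
    (hy : (chartAt (Model n) c).symm z ∈ (chartAt (Model n) y).source) :
    inChart α c z = (inChart α y (coordChange n c y z)).compContinuousLinearMap
      ((fderiv ℂ (coordChange n c y) z).restrictScalars ℝ) := by
  unfold inChart chartInvDeriv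
  rw [symm_coordChange hy, chartInvDerivC_comp hz hy]
  rfl

/-- A form defined in preferred charts, by local expressions that transform as forms. -/
theorem inChart_eq_of_pullback {G : M → Model n → Alt n k} {c : M} {z : Model n}
    (hz : z ∈ (chartAt (Model n) c).target)
    (hG : ∀ y, (chartAt (Model n) c).symm z ∈ (chartAt (Model n) y).source →
      G c z = (G y (coordChange n c y z)).compContinuousLinearMap
        ((fderiv ℂ (coordChange n c y) z).restrictScalars ℝ)) :
    inChart (fun x => G x (chartAt (Model n) x x)) c z = G c z := by
  -- Compare with the preferred chart of the point itself, where the value of the form is its chart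
  -- expression.
  have hy := mem_chart_source (Model n) ((chartAt (Model n) c).symm z)
  rw [hG _ hy]
  unfold inChart chartInvDeriv
  rw [chartInvDerivC_comp hz hy, coordChange, chartInvDerivC_self]
  rfl

/-- The global operator uses, at each point, only the chart preferred there. Naturality under
holomorphic pullback makes the same formula valid throughout any one chart, so that it can be
differentiated again. -/
theorem inChart_twistedDM (a : ℂ) {α : DForm n M k} (hα : IsSmooth α) {c : M} {z : Model n}
    (hz : z ∈ (chartAt (Model n) c).target) :
    inChart (twistedDM a α) c z = twistedD a (inChart α c) z := by
  refine inChart_eq_of_pullback (G := fun x => twistedD a (inChart α x)) hz fun y hy => ?_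
  rw [← twistedD_pullback (hα.differentiableAt (coordChange_mem_target hy))
    (coordChange_contDiffAt hz hy)]
  refine twistedD_congr ?_
  filter_upwards [eventually_mem_target_source hz hy] with w hw
  exact inChart_eq_pullback α hw.1 hw.2

theorem isSmooth_twistedDM (a : ℂ) {α : DForm n M k} (hα : IsSmooth α) :
    IsSmooth (twistedDM a α) := fun c =>
  (twistedD_contDiffOn (chartAt (Model n) c).open_target (hα c)).congr
    fun _ hz => inChart_twistedDM a hα hz

end Charts

/-! ### The metric and its determinant under change of chart -/

section MetricInCharts

variable {n : ℕ} {M : Type*} [TopologicalSpace M] [ChartedSpace (Model n) M]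
  (g : HermitianMetric n M)

theorem bilinInChart_compat (c : M) (z : Model n) (u v : Model n) :
    bilinInChart g.inner c z (mulI n u) (mulI n v) = bilinInChart g.inner c z u v := by
  have h (w : Model n) : chartInvDeriv c z (mulI n w) = mulI n (chartInvDeriv c z w) :=
    (chartInvDerivC c z).map_smul Complex.I w
  simp only [bilinInChart, ContinuousLinearMap.bilinearComp_apply, h, g.compat]

theorem bilinInChart_symm (c : M) (z : Model n) (u v : Model n) :
    bilinInChart g.inner c z u v = bilinInChart g.inner c z v u := by
  simp only [bilinInChart, ContinuousLinearMap.bilinearComp_apply]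
  exact g.symm _ _ _

theorem matrixInChart_eq_matrixAt (c : M) (z : Model n) :
    g.matrixInChart c z = (matrixOf (chartInvDerivC c z)).transpose *
      g.matrixAt ((chartAt (Model n) c).symm z) *
      (matrixOf (chartInvDerivC c z)).map (starRingEnd ℂ) :=
  hermMatrix_comp (g.compat _) _

variable [IsManifold 𝓘(ℂ, Model n) ω M]

theorem bilinInChart_pos {c : M} {z : Model n} (hz : z ∈ (chartAt (Model n) c).target)
    (u : Model n) (hu : u ≠ 0) : 0 < bilinInChart g.inner c z u u :=
  g.pos _ _ fun h => hu (chartInvDerivC_injective hz (h.trans (_root_.map_zero _).symm))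

theorem bilinInChart_eq_pullback (b : M → Model n →L[ℝ] Model n →L[ℝ] ℝ) {c y : M} {z : Model n}
    (hz : z ∈ (chartAt (Model n) c).target)
    (hy : (chartAt (Model n) c).symm z ∈ (chartAt (Model n) y).source) :
    bilinInChart b c z = (bilinInChart b y (coordChange n c y z)).bilinearComp
      ((fderiv ℂ (coordChange n c y) z).restrictScalars ℝ)
      ((fderiv ℂ (coordChange n c y) z).restrictScalars ℝ) := by
  unfold bilinInChart chartInvDeriv
  rw [symm_coordChange hy, chartInvDerivC_comp hz hy]
  rfl

theorem matrixInChart_eq_pullback {c y : M} {z : Model n}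
    (hz : z ∈ (chartAt (Model n) c).target)
    (hy : (chartAt (Model n) c).symm z ∈ (chartAt (Model n) y).source) :
    g.matrixInChart c z = (matrixOf (fderiv ℂ (coordChange n c y) z)).transpose *
      g.matrixInChart y (coordChange n c y z) *
      (matrixOf (fderiv ℂ (coordChange n c y) z)).map (starRingEnd ℂ) := by
  unfold HermitianMetric.matrixInChart
  rw [bilinInChart_eq_pullback g.inner hz hy, hermMatrix_comp (bilinInChart_compat g _ _)]

open scoped ComplexOrder in
theorem matrixInChart_posDef {c : M} {z : Model n} (hz : z ∈ (chartAt (Model n) c).target) :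
    (g.matrixInChart c z).PosDef :=
  hermMatrix_posDef (bilinInChart_compat g c z) (bilinInChart_symm g c z) (bilinInChart_pos g hz)

open scoped ComplexOrder in
theorem matrixInChart_det_pos {c : M} {z : Model n} (hz : z ∈ (chartAt (Model n) c).target) :
    0 < (g.matrixInChart c z).det.re ∧
      (((g.matrixInChart c z).det.re : ℝ) : ℂ) = (g.matrixInChart c z).det := by
  have h := Complex.lt_def.1 (matrixInChart_posDef g hz).det_pos
  exact ⟨h.1, Complex.ext rfl h.2⟩

theorem matrixOf_det_ne_zero {A : Model n →L[ℂ] Model n} (hA : Function.Injective A) :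
    (matrixOf A).det ≠ 0 := by
  rw [matrixOf_eq, LinearMap.det_toMatrix']
  exact ((LinearMap.isUnit_iff_ker_eq_bot _).2 (LinearMap.ker_eq_bot.2 hA)).map LinearMap.det |>.ne_zero

theorem fderiv_coordChange_injective {c y : M} {z : Model n}
    (hz : z ∈ (chartAt (Model n) c).target)
    (hy : (chartAt (Model n) c).symm z ∈ (chartAt (Model n) y).source) :
    Function.Injective (fderiv ℂ (coordChange n c y) z) := by
  have h := chartInvDerivC_injective hz
  rw [chartInvDerivC_comp hz hy] at h
  exact Function.Injective.of_comp h

/-- From g' = Aᵀ g Ā one gets det g' = |det A|² det g. The correction term is log |h|² with `h`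
holomorphic and without zeros. -/
theorem logDet_eq {c y : M} {z : Model n}
    (hz : z ∈ (chartAt (Model n) c).target)
    (hy : (chartAt (Model n) c).symm z ∈ (chartAt (Model n) y).source) :
    g.logDet c z = (g.logDet y (coordChange n c y z)).compContinuousLinearMap
        ((fderiv ℂ (coordChange n c y) z).restrictScalars ℝ) +
      constOfIsEmpty ℝ (Model n) (Fin 0) ((Real.log (Complex.normSq
        (matrixOf (fderiv ℂ (coordChange n c y) z)).det) : ℝ) : ℂ) := by
  set A := matrixOf (fderiv ℂ (coordChange n c y) z)
  have hA : A.det ≠ 0 := matrixOf_det_ne_zero (fderiv_coordChange_injective hz hy)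
  have h2 := matrixInChart_det_pos g (coordChange_mem_target hy)
  have hdet : (g.matrixInChart c z).det.re =
      Complex.normSq A.det * (g.matrixInChart y (coordChange n c y z)).det.re := by
    have hm : (A.map (starRingEnd ℂ)).det = starRingEnd ℂ A.det :=
      ((starRingEnd ℂ).map_det A).symm
    rw [matrixInChart_eq_pullback g hz hy, Matrix.det_mul, Matrix.det_mul, Matrix.det_transpose,
      hm, mul_right_comm, Complex.mul_conj, Complex.re_ofReal_mul]
  ext v
  change ((Real.log (g.matrixInChart c z).det.re : ℝ) : ℂ) =
    ((Real.log (g.matrixInChart y (coordChange n c y z)).det.re : ℝ) : ℂ) +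
      ((Real.log (Complex.normSq A.det) : ℝ) : ℂ)
  rw [hdet, Real.log_mul (by simpa using hA) h2.1.ne']
  push_cast
  ring

end MetricInCharts

/-! ### Smoothness of ω, and ∂∂̄ log det g as a global form -/

section SmoothnessOfMetric

variable {n : ℕ} {M : Type*} [TopologicalSpace M] [ChartedSpace (Model n) M]
  (g : HermitianMetric n M)

/-- The alternating form `(b(iu, v) - b(iv, u)) / 2` of a bilinear form `b`. -/
def formOfBilin (n : ℕ) : (Model n →L[ℝ] Model n →L[ℝ] ℝ) →L[ℝ] Alt n 2 :=
  let P : (Model n →L[ℝ] ℝ) →L[ℝ] Alt n 1 :=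
    ((ofSubsingletonLIE (𝕜 := ℝ) (E := Model n) (F := ℂ) (0 : Fin 1)).toContinuousLinearEquiv :
      (Model n →L[ℝ] ℂ) →L[ℝ] Alt n 1).comp (Complex.ofRealCLM.postcomp (Model n))
  (1 / 2 : ℝ) • (alternatizeUncurryFinCLM ℝ (Model n) ℂ).comp
    ((P.postcomp (Model n)).comp ((mulI n).precomp _))

theorem formOfBilin_apply {b : Model n →L[ℝ] Model n →L[ℝ] ℝ}
    (hb : ∀ u v, b (mulI n u) (mulI n v) = b u v) (hs : ∀ u v, b u v = b v u)
    (v : Fin 2 → Model n) : formOfBilin n b v = (b (mulI n (v 0)) (v 1) : ℂ) := by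
  have h1 : b (mulI n (v 1)) (v 0) = -b (mulI n (v 0)) (v 1) := by
    rw [compat_left hb, hs]
  have h : formOfBilin n b v =
      (1 / 2 : ℝ) • ((b (mulI n (v 0)) (v 1) : ℂ) - (b (mulI n (v 1)) (v 0) : ℂ)) := by
    change (1 / 2 : ℝ) • (alternatizeUncurryFinCLM ℝ (Model n) ℂ _ v) = _
    rw [alternatizeUncurryFinCLM_apply, alternatizeUncurryFin_apply, Fin.sum_univ_two]
    simp [Fin.removeNth, Fin.tail, sub_eq_add_neg]
  rw [h, h1, Complex.real_smul]
  push_cast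
  ring

/-- A fixed continuous linear map carries the metric to ω, so ω inherits its smoothness. -/
theorem inChart_kahlerForm (c : M) (z : Model n) :
    inChart g.kahlerForm c z = formOfBilin n (bilinInChart g.inner c z) := by
  ext v
  rw [formOfBilin_apply (bilinInChart_compat g c z) (bilinInChart_symm g c z)]
  have h (w : Model n) : chartInvDeriv c z (mulI n w) = mulI n (chartInvDeriv c z w) :=
    (chartInvDerivC c z).map_smul Complex.I w
  simp only [bilinInChart, ContinuousLinearMap.bilinearComp_apply, h]
  rfl

theorem isSmooth_kahlerForm : IsSmooth g.kahlerForm := fun c => by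
  have h : ContDiff ℝ ∞ (formOfBilin n) := by fun_prop
  exact (h.comp_contDiffOn (g.smooth c)).congr fun z _ => inChart_kahlerForm g c z

theorem contDiffOn_matrixInChart (c : M) (j k : Fin n) :
    ContDiffOn ℝ ∞ (fun z => g.matrixInChart c z j k) (chartAt (Model n) c).target := by
  have h (u v : Model n) :
      ContDiffOn ℝ ∞ (fun z => (bilinInChart g.inner c z u v : ℂ)) (chartAt (Model n) c).target :=
    Complex.ofRealCLM.contDiff.comp_contDiffOn
      (((g.smooth c).clm_apply contDiffOn_const).clm_apply contDiffOn_const)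
  exact (h _ _).add (contDiffOn_const.mul (h _ _))

theorem contDiffOn_det_matrixInChart (c : M) :
    ContDiffOn ℝ ∞ (fun z => (g.matrixInChart c z).det) (chartAt (Model n) c).target := by
  simp only [Matrix.det_apply]
  refine ContDiffOn.sum fun σ _ => ContDiffOn.const_smul _ ?_
  exact contDiffOn_prod fun i _ => contDiffOn_matrixInChart g c _ _

variable [IsManifold 𝓘(ℂ, Model n) ω M]

theorem contDiffOn_logDet (c : M) :
    ContDiffOn ℝ ∞ (g.logDet c) (chartAt (Model n) c).target := by
  have h1 : ContDiffOn ℝ ∞ (fun z => (g.matrixInChart c z).det.re) (chartAt (Model n) c).target :=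
    Complex.reCLM.contDiff.comp_contDiffOn (contDiffOn_det_matrixInChart g c)
  have h2 := h1.log fun z hz => (matrixInChart_det_pos g hz).1.ne'
  exact ((constOfIsEmptyLIE ℝ (Model n) ℂ (Fin 0)).toContinuousLinearEquiv.contDiff.comp
    Complex.ofRealCLM.contDiff).comp_contDiffOn h2

theorem contDiffAt_logDet {c : M} {z : Model n} (hz : z ∈ (chartAt (Model n) c).target) :
    ContDiffAt ℝ ∞ (g.logDet c) z :=
  (contDiffOn_logDet g c).contDiffAt ((chartAt (Model n) c).open_target.mem_nhds hz)

theorem contDiffAt_twistedD {k : ℕ} (a : ℂ) {F : Model n → Alt n k} {z : Model n}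
    (hF : ContDiffAt ℝ ∞ F z) : ContDiffAt ℝ ∞ (twistedD a F) z :=
  ((alternatizeUncurryFinCLM ℝ (Model n) ℂ).comp (halfProj n _ a)).contDiff.contDiffAt.comp z
    (hF.fderiv_right (m := ∞) (by simp))

theorem contDiffAt_matrixOf_det {f : Model n → Model n} {z : Model n} (hf : ContDiffAt ℂ ∞ f z) :
    ContDiffAt ℂ ∞ (fun w => (matrixOf (fderiv ℂ f w)).det) z := by
  simp only [Matrix.det_apply]
  refine ContDiffAt.sum fun σ _ => ContDiffAt.const_smul _ ?_
  refine contDiffAt_prod fun i _ => ?_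
  have h : ContDiffAt ℂ ∞ (fun w => fderiv ℂ f w (Pi.single i 1)) z :=
    (hf.fderiv_right (m := ∞) (by simp)).clm_apply contDiffAt_const
  exact (contDiffAt_pi.1 h) _

/-- The local functions log det g differ by pluriharmonic terms `H`, so their ∂∂̄ transform as a
form although they do not glue to a function. -/
theorem inChart_deldelbarLogDet {c : M} {z : Model n} (hz : z ∈ (chartAt (Model n) c).target) :
    inChart g.deldelbarLogDet c z =
      twistedD (-Complex.I) (twistedD Complex.I (g.logDet c)) z := by
  have hdef : g.deldelbarLogDet = fun x =>
      twistedD (-Complex.I) (twistedD Complex.I (g.logDet x)) (chartAt (Model n) x x) := by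
    funext x
    rw [HermitianMetric.deldelbarLogDet, delModel_eq, delbarModel_eq]
  rw [hdef]
  refine inChart_eq_of_pullback
    (G := fun x => twistedD (-Complex.I) (twistedD Complex.I (g.logDet x))) hz fun y hy => ?_
  have hψ := coordChange_contDiffAt hz hy
  have hL := contDiffAt_logDet g (coordChange_mem_target hy)
  let H : Model n → Alt n 0 := fun w => constOfIsEmpty ℝ (Model n) (Fin 0)
    ((Real.log (Complex.normSq (matrixOf (fderiv ℂ (coordChange n c y) w)).det) : ℝ) : ℂ)
  let N : Model n → Alt n 0 := fun w =>
    (g.logDet y (coordChange n c y w)).compContinuousLinearMap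
      ((fderiv ℂ (coordChange n c y) w).restrictScalars ℝ)
  have hL2 : ContDiffAt ℝ ∞ N z := by
    have : N = fun w => g.logDet y (coordChange n c y w) := by
      funext w
      ext v
      rfl
    rw [this]
    exact hL.comp z (hψ.restrict_scalars ℝ)
  have hdet : ContDiffAt ℝ ∞ H z := by
    have h0 : (matrixOf (fderiv ℂ (coordChange n c y) z)).det ≠ 0 :=
      matrixOf_det_ne_zero (fderiv_coordChange_injective hz hy)
    have h1 := (contDiffAt_matrixOf_det hψ).restrict_scalars ℝ
    have h2 : ContDiffAt ℝ ∞ (fun w => Complex.normSq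
        (matrixOf (fderiv ℂ (coordChange n c y) w)).det) z := by
      simp only [Complex.normSq_eq_norm_sq]
      exact h1.norm_sq ℝ
    have h3 := h2.log (by simpa using h0)
    exact ((constOfIsEmptyLIE ℝ (Model n) ℂ (Fin 0)).toContinuousLinearEquiv.contDiff.comp
      Complex.ofRealCLM.contDiff).contDiffAt.comp z h3
  have hev : g.logDet c =ᶠ[𝓝 z] fun w => N w + H w := by
    filter_upwards [eventually_mem_target_source hz hy] with w hw
    exact logDet_eq g hw.1 hw.2
  have hev2 : twistedD Complex.I (g.logDet c) =ᶠ[𝓝 z]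
      fun w => (twistedD Complex.I (g.logDet y) (coordChange n c y w)).compContinuousLinearMap
        ((fderiv ℂ (coordChange n c y) w).restrictScalars ℝ) + twistedD Complex.I H w := by
    have hN : ∀ᶠ w in 𝓝 z, DifferentiableAt ℝ N w :=
      ((hL2.of_le two_le_infty).eventually (by simp)).mono fun _ hw => hw.differentiableAt (by simp)
    have hH : ∀ᶠ w in 𝓝 z, DifferentiableAt ℝ H w :=
      ((hdet.of_le two_le_infty).eventually (by simp)).mono
        fun _ hw => hw.differentiableAt (by simp)
    filter_upwards [hev.eventually_nhds, hN, hH, eventually_mem_target_source hz hy]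
      with w hw hNw hHw hwt
    rw [twistedD_congr hw, twistedD_add hNw hHw]
    congr 1
    exact twistedD_pullback ((contDiffAt_logDet g (coordChange_mem_target hwt.2)).differentiableAt
      (by simp)) (coordChange_contDiffAt hwt.1 hwt.2)
  have hT := contDiffAt_twistedD Complex.I hL
  have hDψ : DifferentiableAt ℝ
      (fun w => (fderiv ℂ (coordChange n c y) w).restrictScalars ℝ) z :=
    (ContinuousLinearMap.restrictScalarsL ℂ (Model n) (Model n) ℝ ℝ).differentiableAt.comp z
      (((hψ.fderiv_right (m := ∞) (by simp)).differentiableAt (by simp)).restrictScalars ℝ)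
  have hcomp : DifferentiableAt ℝ (fun w =>
      (twistedD Complex.I (g.logDet y) (coordChange n c y w)).compContinuousLinearMap
        ((fderiv ℂ (coordChange n c y) w).restrictScalars ℝ)) z :=
    DifferentiableAt.continuousAlternatingMapCompContinuousLinearMap
      ((hT.differentiableAt (by simp)).comp z
        ((hψ.differentiableAt (by simp)).restrictScalars ℝ)) hDψ
  rw [twistedD_congr hev2, twistedD_add hcomp
    ((contDiffAt_twistedD Complex.I hdet).differentiableAt (by simp)),
    twistedD_pullback (hT.differentiableAt (by simp)) hψ,
    del_delbar_log_normSq (contDiffAt_matrixOf_det hψ)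
      (matrixOf_det_ne_zero (fderiv_coordChange_injective hz hy)), add_zero]

end SmoothnessOfMetric

/-! ### Types of forms -/

section PointwiseForms

variable {n k p q : ℕ} {M : Type*} {α : DForm n M k}

theorem HasType.comp_mulI (hα : HasType p q α) (x : M) :
    (α x).compContinuousLinearMap (mulI n) = (Complex.I ^ p * (-Complex.I) ^ q) • α x := by
  ext v
  have h := hα.2 x Complex.I v
  rwa [Complex.conj_I] at h

theorem HasType.conj (hα : HasType p q α) : HasType q p fun x => conjForm n k (α x) := by
  refine ⟨(add_comm q p).trans hα.1, fun x c v => ?_⟩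
  rw [conjForm_apply, hα.2, conjForm_apply]
  simp [mul_comm]

end PointwiseForms

/-! ### Type, reality, smoothness and closedness of ω̃ -/

section TildeForm

variable {n : ℕ} {M : Type*} [TopologicalSpace M] [ChartedSpace (Model n) M]

theorem IsSmooth.conj {k : ℕ} {α : DForm n M k} (hs : IsSmooth α) :
    IsSmooth fun x => conjForm n k (α x) := fun c => (conjForm n k).contDiff.comp_contDiffOn (hs c)

theorem HasType.inChart_comp_mulI {k p q : ℕ} {α : DForm n M k} (hα : HasType p q α) (c : M)
    (z : Model n) : (inChart α c z).compContinuousLinearMap (mulI n) =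
      (Complex.I ^ p * (-Complex.I) ^ q) • inChart α c z := by
  have h (w : Model n) : chartInvDeriv c z (mulI n w) = mulI n (chartInvDeriv c z w) :=
    (chartInvDerivC c z).map_smul Complex.I w
  ext v
  have h2 := congrArg (fun A => A (chartInvDeriv c z ∘ v))
    (hα.comp_mulI ((chartAt (Model n) c).symm z))
  simp only [inChart, compContinuousLinearMap_apply, ContinuousAlternatingMap.smul_apply] at h2 ⊢
  rw [← h2]
  congr 1
  funext j
  exact h (v j)

theorem twistedDM_comp_mulI {k p q : ℕ} {α : DForm n M k} (hs : IsSmooth α) (hα : HasType p q α)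
    {a : ℂ} (ha : a * a = -1) (x : M) :
    (twistedDM a α x).compContinuousLinearMap (mulI n) =
      (-a * (Complex.I ^ p * (-Complex.I) ^ q)) • twistedDM a α x :=
  twistedD_comp_mulI ha (hs.differentiableAt (mem_chart_target (Model n) x))
    (Filter.Eventually.of_forall fun z => hα.inChart_comp_mulI x z)

theorem twistedDM_conjForm {k : ℕ} {α : DForm n M k} (hs : IsSmooth α) (a : ℂ) :
    twistedDM a (fun x => conjForm n k (α x)) =
      fun x => conjForm n (k + 1) (twistedDM (starRingEnd ℂ a) α x) := by
  funext x
  have e : inChart (fun x => conjForm n k (α x)) x = fun z => conjForm n k (inChart α x z) := rfl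
  rw [twistedDM, e, twistedD_conjForm (hs.differentiableAt (mem_chart_target (Model n) x)),
    twistedDM]

variable (g : HermitianMetric n M) {τ σ : DForm n M 1} {lam : ℝ}

/-- J acts by -1 on ∂̄τ and on ∂σ, which averaging over J removes, and by 1 on ω. -/
theorem part11_kahlerForm_sub (a : ℂ) (hτ : IsSmooth τ) (hσ : IsSmooth σ) (tτ : HasType 0 1 τ)
    (tσ : HasType 1 0 σ) :
    part11 (g.kahlerForm - a • (delbar τ + del σ)) = g.kahlerForm := by
  funext x
  have h1 := twistedDM_comp_mulI hτ tτ Complex.I_mul_I x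
  have h2 := twistedDM_comp_mulI (a := -Complex.I) hσ tσ (by simp) x
  have h3 : (g.kahlerForm x).compContinuousLinearMap (mulI n) = g.kahlerForm x := by
    ext v
    change ((g.inner x (mulI n (mulI n (v 0))) (mulI n (v 1)) : ℝ) : ℂ) = g.inner x (mulI n (v 0)) (v 1)
    rw [g.compat]
  simp only [pow_zero, pow_one, one_mul, mul_one, neg_mul_neg, Complex.I_mul_I, neg_neg]
    at h1 h2
  rw [delbar_eq, del_eq]
  have h4 : ((g.kahlerForm - a • (twistedDM Complex.I τ + twistedDM (-Complex.I) σ)) x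
      ).compContinuousLinearMap (mulI n) =
      (g.kahlerForm x).compContinuousLinearMap (mulI n) -
        a • ((twistedDM Complex.I τ x).compContinuousLinearMap (mulI n) +
          (twistedDM (-Complex.I) σ x).compContinuousLinearMap (mulI n)) := rfl
  rw [part11, h4, h1, h2, h3]
  simp only [Pi.sub_apply, Pi.smul_apply, Pi.add_apply]
  module

/-- When σ = conj τ, the forms ∂σ and ∂̄τ are conjugate, so their sum is real. -/
theorem isReal_kahlerForm_sub (r : ℝ) (hτ : IsSmooth τ)
    (h : σ = fun x => conjForm n 1 (τ x)) :
    IsReal (g.kahlerForm - (r : ℂ) • (delbar τ + del σ)) := by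
  intro x v
  have h1 : del σ x v = starRingEnd ℂ (delbar τ x v) := by
    rw [h, del_eq, delbar_eq, twistedDM_conjForm hτ]
    simp
  have h2 : (g.kahlerForm - (r : ℂ) • (delbar τ + del σ)) x v =
      ((g.inner x (mulI n (v 0)) (v 1) : ℝ) : ℂ) - r * (delbar τ x v + del σ x v) := rfl
  rw [h2, h1, Complex.add_conj, ← Complex.ofReal_mul, ← Complex.ofReal_sub, Complex.ofReal_im]

variable [IsManifold 𝓘(ℂ, Model n) ω M]

theorem isSmooth_kahlerForm_sub (a : ℂ) (hτ : IsSmooth τ) (hσ : IsSmooth σ) :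
    IsSmooth (g.kahlerForm - a • (delbar τ + del σ)) := by
  rw [delbar_eq, del_eq]
  intro c
  have h1 := (isSmooth_twistedDM Complex.I hτ c).add (isSmooth_twistedDM (-Complex.I) hσ c)
  have h2 := (isSmooth_kahlerForm g c).sub (h1.const_smul a)
  have e : inChart (g.kahlerForm - a • (twistedDM Complex.I τ + twistedDM (-Complex.I) σ)) c =
      fun z => inChart g.kahlerForm c z -
        a • (inChart (twistedDM Complex.I τ) c z + inChart (twistedDM (-Complex.I) σ) c z) := rfl
  rw [e]
  exact h2

theorem extD_kahlerForm_sub (hτ : IsSmooth τ) (hσ : IsSmooth σ) (hlam : lam ≠ 0)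
    (heq : -del τ - delbar σ - (Complex.I / 2) • g.deldelbarLogDet = (lam : ℂ) • g.kahlerForm) :
    extD (g.kahlerForm - (lam : ℂ)⁻¹ • (delbar τ + del σ)) = 0 := by
  funext x
  let U := (chartAt (Model n) x).target
  let L := g.logDet x
  -- A primitive of -λ ω̃ in the chart: ∂ and ∂̄ of τ and σ supply all four first-order terms, while
  -- ∂̄ kills the ∂̄ log det g term.
  let G : Model n → Alt n 1 := fun z =>
    inChart τ x z + inChart σ x z + (Complex.I / 2) • twistedD Complex.I L z
  have hx := mem_chart_target (Model n) x
  have hLsm {z : Model n} (hz : z ∈ U) := contDiffAt_twistedD Complex.I (contDiffAt_logDet g hz)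
  have hG {z : Model n} (hz : z ∈ U) : ContDiffAt ℝ ∞ G z :=
    ((hτ.contDiffAt hz).add (hσ.contDiffAt hz)).add ((hLsm hz).const_smul _)
  have hkey {z : Model n} (hz : z ∈ U) :
      inChart (g.kahlerForm - (lam : ℂ)⁻¹ • (delbar τ + del σ)) x z =
        (-lam⁻¹) • extDeriv G z := by
    have e1 : inChart (-del τ - delbar σ - (Complex.I / 2) • g.deldelbarLogDet) x z =
        -inChart (del τ) x z - inChart (delbar σ) x z -
          (Complex.I / 2) • inChart g.deldelbarLogDet x z := rfl
    have e2 : inChart ((lam : ℂ) • g.kahlerForm) x z = (lam : ℂ) • inChart g.kahlerForm x z := rfl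
    rw [heq, e2, del_eq, delbar_eq, inChart_twistedDM _ hτ hz, inChart_twistedDM _ hσ hz,
      inChart_deldelbarLogDet g hz] at e1
    have e3 : inChart (g.kahlerForm - (lam : ℂ)⁻¹ • (delbar τ + del σ)) x z =
        inChart g.kahlerForm x z -
          (lam : ℂ)⁻¹ • (inChart (delbar τ) x z + inChart (del σ) x z) := rfl
    rw [del_eq, delbar_eq, inChart_twistedDM _ hτ hz, inChart_twistedDM _ hσ hz] at e3
    have hLs : DifferentiableAt ℝ (fun z => (Complex.I / 2) • twistedD Complex.I L z) z :=
      ((hLsm hz).differentiableAt (by simp)).const_smul (Complex.I / 2)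
    have hd (a : ℂ) : twistedD a G z = twistedD a (inChart τ x) z + twistedD a (inChart σ x) z +
        (Complex.I / 2) • twistedD a (twistedD Complex.I L) z := by
      rw [twistedD_add (F := fun z => inChart τ x z + inChart σ x z)
        (G := fun z => (Complex.I / 2) • twistedD Complex.I L z)
        ((hτ.differentiableAt hz).add (hσ.differentiableAt hz)) hLs,
        twistedD_add (hτ.differentiableAt hz) (hσ.differentiableAt hz),
        twistedD_smul _ ((hLsm hz).differentiableAt (by simp))]
    have hl : (lam : ℂ) ≠ 0 := by exact_mod_cast hlam
    have e4 : inChart g.kahlerForm x z = (lam : ℂ)⁻¹ • ((lam : ℂ) • inChart g.kahlerForm x z) := by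
      rw [inv_smul_smul₀ hl]
    have e5 (A : Alt n 2) : (-lam⁻¹) • A = (-(lam : ℂ)⁻¹) • A := by
      ext v
      simp
    rw [del_eq, delbar_eq, e3, e4, e1, e5, ← twistedD_neg_I_add_twistedD_I, hd, hd,
      twistedD_twistedD _ (contDiffAt_logDet g hz)]
    module
  have hev : inChart (g.kahlerForm - (lam : ℂ)⁻¹ • (delbar τ + del σ)) x
      =ᶠ[𝓝 (chartAt (Model n) x x)] (-lam⁻¹) • extDeriv G :=
    Filter.eventually_of_mem ((chartAt (Model n) x).open_target.mem_nhds hx) fun z hz => hkey hz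
  rw [extD, hev.extDeriv_eq, extDeriv_smul,
    extDeriv_extDeriv_apply (hG hx) (by simpa using two_le_infty), smul_zero]
  rfl

end TildeForm

end Forms

/-! ### Positivity of the Pfaffian on a symplectic family -/

section Pfaffian

open Equiv

/-- The numbering of `m` pairs. -/
def pairEquiv (m : ℕ) : Fin m × Fin 2 ≃ Fin (2 * m) where
  toFun x := ⟨2 * x.1 + x.2, by omega⟩
  invFun t := (⟨t / 2, by omega⟩, ⟨t % 2, by omega⟩)
  left_inv x := by
    ext
    · simp only
      omega
    · simp only
      omega
  right_inv t := by
    ext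
    simp only
    omega

/-- The entries of the standard symplectic matrix. -/
def stdSymplectic {m : ℕ} (x y : Fin m × Fin 2) : ℝ :=
  if x.1 = y.1 then (y.2 : ℕ) - (x.2 : ℕ) else 0

/-- The product vanishes unless ρ maps pairs to pairs. In that case ρ is a permutation of the pairs
composed with flips inside them; both the sign of ρ and the product equal the product of the signs
of the flips, so the term is a square. -/
theorem sign_mul_prod_stdSymplectic_nonneg {m : ℕ} (ρ : Perm (Fin m × Fin 2)) :
    0 ≤ ((Perm.sign ρ : ℤ) : ℝ) * ∏ a, stdSymplectic (ρ (a, 0)) (ρ (a, 1)) := by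
  by_cases h : ∀ a, (ρ (a, 0)).1 = (ρ (a, 1)).1
  · have hfst (x : Fin m × Fin 2) : (ρ x).1 = (ρ (x.1, 0)).1 := by
      obtain ⟨a, s⟩ := x
      fin_cases s
      · rfl
      · exact (h a).symm
    let π : Perm (Fin m) := Equiv.ofBijective (fun a => (ρ (a, 0)).1) <|
      Finite.surjective_iff_bijective.1 fun b => by
        obtain ⟨x, hx⟩ := ρ.surjective (b, 0)
        exact ⟨x.1, by simp [← hfst, hx]⟩
    let ε (a : Fin m) : Perm (Fin 2) := Equiv.ofBijective (fun s => (ρ (a, s)).2) <|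
      Finite.injective_iff_bijective.1 fun s t hst => by
        have h1 : ρ (a, s) = ρ (a, t) := Prod.ext ((hfst (a, s)).trans (hfst (a, t)).symm) hst
        simpa using ρ.injective h1
    have hρ : ρ = prodCongrLeft (fun _ : Fin 2 => π) * prodCongrRight ε := by
      ext1 x
      exact Prod.ext (hfst x) rfl
    -- The permutation π of pairs acts on two copies of the index set and contributes sign(π)² = 1.
    have hsign : (Perm.sign ρ : ℤ) = ∏ a, (Perm.sign (ε a) : ℤ) := by
      rw [hρ, Perm.sign_mul, Perm.sign_prodCongrLeft, Perm.sign_prodCongrRight, Fin.prod_univ_two,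
        Int.units_mul_self, one_mul, Units.coe_prod]
    have htwo : ∀ e : Perm (Fin 2), ((e 1 : ℕ) : ℤ) - (e 0 : ℕ) = Perm.sign e := by decide
    have hterm (a : Fin m) :
        stdSymplectic (ρ (a, 0)) (ρ (a, 1)) = ((Perm.sign (ε a) : ℤ) : ℝ) := by
      rw [stdSymplectic, if_pos (h a), ← htwo]
      push_cast
      rfl
    rw [hsign, Finset.prod_congr rfl fun a _ => hterm a, ← Int.cast_prod]
    exact mul_self_nonneg _
  · obtain ⟨a, ha⟩ := not_forall.1 h
    rw [Finset.prod_eq_zero (Finset.mem_univ a) (by rw [stdSymplectic, if_neg ha]), mul_zero]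

variable {V : Type*}

/-- The Pfaffian (up to a positive factor) of the matrix `B (v i) (v j)`. -/
def pfaffianSum {m : ℕ} (B : V → V → ℝ) (v : Fin (2 * m) → V) : ℝ :=
  ∑ σ : Perm (Fin (2 * m)), ((Perm.sign σ : ℤ) : ℝ) *
    ∏ i : Fin m, B (v (σ (pairEquiv m (i, 0)))) (v (σ (pairEquiv m (i, 1))))

/-- No term is negative, and the identity permutation contributes 1. -/
theorem pfaffianSum_pos {m : ℕ} {B : V → V → ℝ} {v : Fin (2 * m) → V}
    (h : ∀ x y, B (v (pairEquiv m x)) (v (pairEquiv m y)) = stdSymplectic x y) :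
    0 < pfaffianSum B v := by
  have hterm (ρ : Perm (Fin m × Fin 2)) :
      ((Perm.sign ((pairEquiv m).permCongr ρ) : ℤ) : ℝ) *
        ∏ i : Fin m, B (v ((pairEquiv m).permCongr ρ (pairEquiv m (i, 0))))
          (v ((pairEquiv m).permCongr ρ (pairEquiv m (i, 1)))) =
      ((Perm.sign ρ : ℤ) : ℝ) * ∏ a, stdSymplectic (ρ (a, 0)) (ρ (a, 1)) := by
    simp only [Perm.sign_permCongr, permCongr_apply, symm_apply_apply, h]
  rw [pfaffianSum, ← Equiv.sum_comp (pairEquiv m).permCongr]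
  refine Finset.sum_pos' (fun ρ _ => ?_) ⟨1, Finset.mem_univ _, ?_⟩
  · rw [hterm]
    exact sign_mul_prod_stdSymplectic_nonneg ρ
  · rw [hterm]
    simp [stdSymplectic]

end Pfaffian

/-! ### Top powers evaluated on real frames -/

section WedgePow

variable {n : ℕ}

theorem wedgePow_eq_pfaffianSum {m : ℕ} {φ : Alt n 2} {B : Model n → Model n → ℝ}
    (h : ∀ u w, φ ![u, w] = (B u w : ℂ)) (v : Fin (2 * m) → Model n) :
    wedgePow φ m v = (((1 / 2) ^ m * pfaffianSum B v : ℝ) : ℂ) := by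
  rw [wedgePow, ContinuousAlternatingMap.smul_apply,
    ContinuousMultilinearMap.alternatization_apply_apply, pfaffianSum]
  push_cast
  rw [smul_eq_mul]
  congr 1
  refine Finset.sum_congr rfl fun σ _ => ?_
  have h1 : tensorPow φ m (v ∘ σ) =
      ∏ i : Fin m, (B (v (σ (pairEquiv m (i, 0)))) (v (σ (pairEquiv m (i, 1)))) : ℂ) := by
    simp only [← h]
    rfl
  rw [h1, Units.smul_def, zsmul_eq_mul]

theorem realFrame_pairEquiv (a : Fin n) (s : Fin 2) :
    realFrame n (pairEquiv n (a, s)) = Pi.single a (if s = 0 then 1 else Complex.I) := by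
  have ha : (⟨(pairEquiv n (a, s) : ℕ) / 2, by omega⟩ : Fin n) = a := by
    ext
    simp only [pairEquiv, Equiv.coe_fn_mk]
    omega
  rw [realFrame, ha]
  congr 1
  fin_cases s <;> simp [pairEquiv, Nat.add_mod]

/-- The real basis of `ℂⁿ` given by `realFrame`. -/
theorem exists_basis_realFrame (n : ℕ) :
    ∃ b : Module.Basis (Fin (2 * n)) ℝ (Model n), ⇑b = realFrame n := by
  refine ⟨(Pi.basis fun _ : Fin n => Complex.basisOneI).reindex
    ((Equiv.sigmaEquivProd (Fin n) (Fin 2)).trans (pairEquiv n)), ?_⟩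
  funext t
  obtain ⟨⟨a, s⟩, rfl⟩ := (pairEquiv n).surjective t
  rw [Module.Basis.reindex_apply, Equiv.symm_trans_apply, Equiv.symm_apply_apply,
    Equiv.sigmaEquivProd_symm_apply, Pi.basis_apply]
  rw [realFrame_pairEquiv]
  congr 1
  fin_cases s <;> simp

/-- Any other injective choice of basis vectors is a permutation of the frame, so a top-degree form
is determined by its value there. -/
theorem wedgePow_eq_zero_of_realFrame {φ : Alt n 2} (h : wedgePow φ n (realFrame n) = 0) :
    wedgePow φ n = 0 := by
  obtain ⟨b, hb⟩ := exists_basis_realFrame n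
  apply ContinuousAlternatingMap.toAlternatingMap_injective
  refine Module.Basis.ext_alternating b fun i hi => ?_
  let σ : Equiv.Perm (Fin (2 * n)) := Equiv.ofBijective i (Finite.injective_iff_bijective.1 hi)
  change (wedgePow φ n).toAlternatingMap (b ∘ σ) = 0
  rw [AlternatingMap.map_perm, hb]
  change _ • wedgePow φ n (realFrame n) = 0
  rw [h, smul_zero]

end WedgePow

/-! ### Symplectic Gram–Schmidt -/

section SymplecticBasis

variable {V : Type*} [AddCommGroup V] [Module ℝ V] [FiniteDimensional ℝ V]

/-- A nondegenerate alternating form has symplectic families of `m` pairs of vectors for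
all `m ≤ (dim V) / 2`. -/
theorem exists_symplectic_family {B : V →ₗ[ℝ] V →ₗ[ℝ] ℝ} (halt : ∀ u w, B u w = -B w u)
    (hnd : ∀ u, u ≠ 0 → ∃ w, B u w ≠ 0) {m : ℕ} (hm : 2 * m ≤ Module.finrank ℝ V) :
    ∃ p q : Fin m → V, (∀ a b, B (p a) (p b) = 0) ∧ (∀ a b, B (q a) (q b) = 0) ∧
      ∀ a b, B (p a) (q b) = if a = b then 1 else 0 := by
  induction m with
  | zero => exact ⟨Fin.elim0, Fin.elim0, fun a => a.elim0, fun a => a.elim0, fun a => a.elim0⟩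
  | succ m ih =>
    obtain ⟨p, q, hp, hq, hpq⟩ := ih (by omega)
    have hqp (a b : Fin m) : B (q a) (p b) = -if a = b then 1 else 0 := by
      rw [halt, hpq]
      simp only [eq_comm]
    have hself (u : V) : B u u = 0 := by linarith [halt u u]
    -- The kernel of `T` is the symplectic complement of the family; it is nonzero because 2m is
    -- less than dim V.
    let T : V →ₗ[ℝ] (Fin m → ℝ) × (Fin m → ℝ) :=
      (LinearMap.pi fun a => B (p a)).prod (LinearMap.pi fun a => B (q a))
    have hker : LinearMap.ker T ≠ ⊥ := by
      apply LinearMap.ker_ne_bot_of_finrank_lt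
      simp
      omega
    obtain ⟨u, hu, hu0⟩ := (Submodule.ne_bot_iff _).1 hker
    have hTu : T u = 0 := hu
    have hpu (a : Fin m) : B (p a) u = 0 := congrFun (congrArg Prod.fst hTu) a
    have hqu (a : Fin m) : B (q a) u = 0 := congrFun (congrArg Prod.snd hTu) a
    obtain ⟨w, hw⟩ := hnd u hu0
    -- Projection of `w` to that complement. As `u` already lies there, B(u, w) is unchanged, and
    -- rescaling makes it 1.
    let w' : V := w - ∑ a, (B (p a) w • q a - B (q a) w • p a)
    have hpw (b : Fin m) : B (p b) w' = 0 := by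
      simp [w', map_sub, map_sum, hp, hpq, Finset.sum_ite_eq]
    have hqw (b : Fin m) : B (q b) w' = 0 := by
      simp [w', map_sub, map_sum, hq, hqp, Finset.sum_ite_eq]
    have huw : B u w' = B u w := by
      have h1 (a : Fin m) : B u (p a) = 0 := by rw [halt, hpu, neg_zero]
      have h2 (a : Fin m) : B u (q a) = 0 := by rw [halt, hqu, neg_zero]
      simp [w', map_sub, map_sum, h1, h2]
    refine ⟨Fin.cons u p, Fin.cons ((B u w)⁻¹ • w') q, fun a b => ?_, fun a b => ?_, fun a b => ?_⟩
    · cases a using Fin.cases <;> cases b using Fin.cases <;>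
        simp [hself, hpu, hp, halt u (p _)]
    · cases a using Fin.cases <;> cases b using Fin.cases <;>
        simp [hself, hqw, hq, halt w' (q _)]
    · cases a using Fin.cases <;> cases b using Fin.cases <;>
        simp [huw, hw, hpw, hpq, halt u (q _), hqu, Fin.succ_ne_zero, (Fin.succ_ne_zero _).symm]

end SymplecticBasis

/-! ### Taming forms have positive top power -/

section Taming

variable {n : ℕ}

theorem alt2_swap (φ : Alt n 2) (u w : Model n) : φ ![u, w] = -φ ![w, u] := by
  have h0 (x : Model n) : φ ![x, x] = 0 :=
    φ.map_eq_zero_of_eq _ (i := 0) (j := 1) rfl (by decide)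
  have h := h0 (u + w)
  rw [alt2_add_left, alt2_add_right, alt2_add_right, h0, h0, zero_add, add_zero] at h
  exact eq_neg_of_add_eq_zero_left h

/-- The top power is positive on a symplectic basis, hence not the zero form. Only nonvanishing on
the frame follows, since the symplectic basis may have the opposite orientation. -/
theorem wedgePow_realFrame_ne_zero {φ : Alt n 2} (hre : ∀ v, (φ v).im = 0)
    (hnd : ∀ u, u ≠ 0 → ∃ w, (φ ![u, w]).re ≠ 0) : wedgePow φ n (realFrame n) ≠ 0 := by
  intro h0
  let B : Model n →ₗ[ℝ] Model n →ₗ[ℝ] ℝ := LinearMap.mk₂ ℝ (fun u w => (φ ![u, w]).re)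
    (fun x y w => by rw [alt2_add_left, Complex.add_re])
    (fun c x w => by rw [alt2_smul_left, Complex.smul_re])
    (fun w x y => by rw [alt2_add_right, Complex.add_re])
    (fun c w x => by rw [alt2_smul_right, Complex.smul_re])
  have halt (u w : Model n) : B u w = -B w u := by
    change (φ ![u, w]).re = -(φ ![w, u]).re
    rw [alt2_swap, Complex.neg_re]
  have hdim : Module.finrank ℝ (Model n) = 2 * n := by
    obtain ⟨b, -⟩ := exists_basis_realFrame n
    simpa using Module.finrank_eq_card_basis b
  obtain ⟨p, q, hp, hq, hpq⟩ := exists_symplectic_family (B := B) (m := n) halt hnd hdim.ge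
  let v : Fin (2 * n) → Model n := fun t =>
    if ((pairEquiv n).symm t).2 = 0 then p ((pairEquiv n).symm t).1 else q ((pairEquiv n).symm t).1
  have hv : ∀ x y, B (v (pairEquiv n x)) (v (pairEquiv n y)) = stdSymplectic x y := by
    rintro ⟨a, s⟩ ⟨b, t⟩
    have hqp : B (q a) (p b) = -if a = b then 1 else 0 := by
      rw [halt, hpq]
      simp only [eq_comm]
    simp only [v, Equiv.symm_apply_apply, stdSymplectic]
    fin_cases s <;> fin_cases t <;> simp [hp, hq, hpq, hqp]
    split_ifs <;> simp
  have hB (u w : Model n) : φ ![u, w] = (B u w : ℂ) := Complex.ext rfl (hre _)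
  have h1 := wedgePow_eq_pfaffianSum hB v
  rw [wedgePow_eq_zero_of_realFrame h0, ContinuousAlternatingMap.coe_zero, Pi.zero_apply] at h1
  have h2 := pfaffianSum_pos (B := fun u w => B u w) hv
  have h3 : ((1 / 2) ^ n * pfaffianSum (fun u w => B u w) v : ℝ) = 0 := by
    exact_mod_cast h1.symm
  have h4 : (0 : ℝ) < (1 / 2) ^ n := by positivity
  exact (mul_pos h4 h2).ne' h3

/-- The Euclidean inner product of `ℂⁿ`. -/
def euclideanBilin (n : ℕ) : Model n →L[ℝ] Model n →L[ℝ] ℝ :=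
  ∑ j : Fin n,
    ((Complex.reCLM.comp (ContinuousLinearMap.proj j)).smulRight
        (Complex.reCLM.comp (ContinuousLinearMap.proj j)) +
      (Complex.imCLM.comp (ContinuousLinearMap.proj j)).smulRight
        (Complex.imCLM.comp (ContinuousLinearMap.proj j)))

theorem euclideanBilin_apply (u w : Model n) :
    euclideanBilin n u w = ∑ j, ((u j).re * (w j).re + (u j).im * (w j).im) := by
  simp [euclideanBilin, _root_.sum_apply]

/-- A real two-form that tames the complex structure has positive top power. -/
theorem wedgePow_realFrame_pos {φ : Alt n 2} (hre : ∀ v, (φ v).im = 0)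
    (htame : ∀ u, u ≠ 0 → 0 < (φ ![u, mulI n u]).re) :
    ∃ r : ℝ, 0 < r ∧ wedgePow φ n (realFrame n) = (r : ℂ) := by
  have hb (u v : Model n) :
      euclideanBilin n (mulI n u) (mulI n v) = euclideanBilin n u v := by
    simp only [euclideanBilin_apply, mulI_apply, Pi.smul_apply, smul_eq_mul, Complex.I_mul_re,
      Complex.I_mul_im]
    exact Finset.sum_congr rfl fun j _ => by ring
  have hs (u v : Model n) : euclideanBilin n u v = euclideanBilin n v u := by
    simp only [euclideanBilin_apply, mul_comm]
  let φ₀ : Alt n 2 := formOfBilin n (euclideanBilin n)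
  have h₀ (u w : Model n) : φ₀ ![u, w] = (euclideanBilin n (mulI n u) w : ℂ) :=
    formOfBilin_apply hb hs _
  -- The segment from the standard form to φ. Taming is a convex condition, so every `Φ t` with t in
  -- [0, 1] is nondegenerate.
  let Φ (t : ℝ) : Alt n 2 := (1 - t) • φ₀ + t • φ
  let B (t : ℝ) (u w : Model n) : ℝ :=
    (1 - t) * euclideanBilin n (mulI n u) w + t * (φ ![u, w]).re
  have hφ (u w : Model n) : φ ![u, w] = ((φ ![u, w]).re : ℂ) := Complex.ext rfl (hre _)
  have hΦ (t : ℝ) (u w : Model n) : Φ t ![u, w] = (B t u w : ℂ) := by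
    change (1 - t) • φ₀ ![u, w] + t • φ ![u, w] = _
    rw [h₀, hφ]
    simp [B]
  have hΦre (t : ℝ) (v : Fin 2 → Model n) : (Φ t v).im = 0 := by
    have hv : v = ![v 0, v 1] := by
      ext j : 1
      fin_cases j <;> rfl
    rw [hv, hΦ, Complex.ofReal_im]
  let f (t : ℝ) : ℝ := (1 / 2) ^ n * pfaffianSum (B t) (realFrame n)
  have hf (t : ℝ) : wedgePow (Φ t) n (realFrame n) = (f t : ℂ) :=
    wedgePow_eq_pfaffianSum (hΦ t) _
  have hcont : Continuous f := by
    simp only [f, pfaffianSum, B]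
    fun_prop
  -- The oriented frame is itself symplectic for the standard form, which fixes the sign.
  have hf0 : 0 < f 0 := by
    refine mul_pos (by positivity) (pfaffianSum_pos ?_)
    rintro ⟨a, s⟩ ⟨b, t⟩
    simp only [B, sub_zero, one_mul, zero_mul, add_zero, euclideanBilin_apply,
      realFrame_pairEquiv, stdSymplectic]
    by_cases hab : a = b
    · subst hab
      rw [Finset.sum_eq_single a]
      · fin_cases s <;> fin_cases t <;> simp
      · intro j _ hj
        simp [hj]
      · simp
    · refine (Finset.sum_eq_zero fun j _ => ?_).trans (by simp [hab])
      by_cases hj : j = a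
      · subst hj
        simp [hab]
      · simp [hj]
  have hne (t : ℝ) (ht : t ∈ Set.Icc (0 : ℝ) 1) : f t ≠ 0 := by
    have h1 := wedgePow_realFrame_ne_zero (hΦre t) fun u hu => ⟨mulI n u, ?_⟩
    · rw [hf] at h1
      exact_mod_cast h1
    · rw [hΦ, Complex.ofReal_re]
      have e1 : 0 < euclideanBilin n (mulI n u) (mulI n u) := by
        rw [hb, euclideanBilin_apply]
        obtain ⟨j, hj⟩ := Function.ne_iff.1 hu
        refine Finset.sum_pos' (fun j _ => add_nonneg (mul_self_nonneg _) (mul_self_nonneg _))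
          ⟨j, Finset.mem_univ _, ?_⟩
        have := Complex.normSq_pos.2 hj
        rwa [Complex.normSq_apply] at this
      have e2 := htame u hu
      obtain ⟨ht0, ht1⟩ := ht
      have e3 : 0 < B t u (mulI n u) := by
        simp only [B]
        rcases ht0.eq_or_lt with rfl | ht0
        · simpa using e1
        · have := mul_nonneg (sub_nonneg.2 ht1) e1.le
          have := mul_pos ht0 e2
          linarith
      exact e3.ne'
  have hf1 : 0 < f 1 := by
    by_contra hneg
    obtain ⟨t, ht, ht0⟩ := intermediate_value_Icc' (zero_le_one' ℝ) hcont.continuousOn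
      ⟨not_lt.1 hneg, hf0.le⟩
    exact hne t ht ht0
  have hΦ1 : Φ 1 = φ := by
    ext v
    change (1 - 1 : ℝ) • φ₀ v + (1 : ℝ) • φ v = φ v
    simp
  exact ⟨f 1, hf1, by rw [← hf, hΦ1]⟩

end Taming

/-! ### Integration against a partition of unity -/

section ChartIntegral

open MeasureTheory

variable {n : ℕ} {M : Type*} [TopologicalSpace M] [ChartedSpace (Model n) M]
  [CompactSpace M] [T2Space M]

/-- The sum of the integrals of local densities against a partition of unity. -/
def chartIntegral {𝕜 : Type*} [RCLike 𝕜] (F : M → Model n → 𝕜) : 𝕜 :=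
  ∑ᶠ c : M, ∫ z in (chartAt (Model n) c).target,
    (chartPartition n M c ((chartAt (Model n) c).symm z) : 𝕜) * F c z

variable (n M) in
theorem finite_support_chartPartition :
    {c : M | (Function.support (chartPartition n M c)).Nonempty}.Finite :=
  (chartPartition n M).locallyFinite.finite_nonempty_of_compact

variable {𝕜 : Type*} [RCLike 𝕜]

theorem support_chartIntegral_subset (F : M → Model n → 𝕜) :
    (Function.support fun c : M => ∫ z in (chartAt (Model n) c).target,
      (chartPartition n M c ((chartAt (Model n) c).symm z) : 𝕜) * F c z) ⊆
      (finite_support_chartPartition n M).toFinset := by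
  intro c hc
  rw [Set.Finite.coe_toFinset]
  by_contra h
  refine hc ?_
  have h0 (x : M) : chartPartition n M c x = 0 := by
    by_contra hx
    exact h ⟨x, hx⟩
  simp [h0]

theorem chartIntegral_eq_sum (F : M → Model n → 𝕜) :
    chartIntegral F = ∑ c ∈ (finite_support_chartPartition n M).toFinset,
      ∫ z in (chartAt (Model n) c).target,
        (chartPartition n M c ((chartAt (Model n) c).symm z) : 𝕜) * F c z :=
  finsum_eq_sum_of_support_subset _ (support_chartIntegral_subset F)

theorem continuousOn_chartPartition_mul {F : Model n → 𝕜} {c : M}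
    (hF : ContinuousOn F (chartAt (Model n) c).target) :
    ContinuousOn (fun z => (chartPartition n M c ((chartAt (Model n) c).symm z) : 𝕜) * F z)
      (chartAt (Model n) c).target :=
  (RCLike.continuous_ofReal.comp_continuousOn ((chartPartition n M c).continuous.comp_continuousOn
    (chartAt (Model n) c).continuousOn_symm)).mul hF

/-- `F` may be unbounded near the boundary of the chart, but the cutoff is supported in a compact
part of the target. -/
theorem integrableOn_chartPartition_mul {F : Model n → 𝕜} {c : M}
    (hF : ContinuousOn F (chartAt (Model n) c).target) :
    IntegrableOn (fun z => (chartPartition n M c ((chartAt (Model n) c).symm z) : 𝕜) * F z)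
      (chartAt (Model n) c).target := by
  have hsub : tsupport (chartPartition n M c) ⊆ (chartAt (Model n) c).source :=
    (exists_chart_partition n M).choose_spec c
  have hK : IsCompact (chartAt (Model n) c '' tsupport (chartPartition n M c)) :=
    (isClosed_tsupport _).isCompact.image_of_continuousOn
      ((chartAt (Model n) c).continuousOn.mono hsub)
  have hKt : chartAt (Model n) c '' tsupport (chartPartition n M c) ⊆
      (chartAt (Model n) c).target := by
    rintro _ ⟨x, hx, rfl⟩
    exact (chartAt (Model n) c).map_source (hsub hx)
  refine (((continuousOn_chartPartition_mul hF).mono hKt).integrableOn_compact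
    hK).of_forall_sdiff_eq_zero (chartAt (Model n) c).open_target.measurableSet fun z hz => ?_
  have h0 : chartPartition n M c ((chartAt (Model n) c).symm z) = 0 := by
    by_contra h
    exact hz.2 ⟨_, subset_tsupport _ h, (chartAt (Model n) c).right_inv hz.1⟩
  simp [h0]

theorem chartIntegral_sub {F G : M → Model n → 𝕜}
    (hF : ∀ c, ContinuousOn (F c) (chartAt (Model n) c).target)
    (hG : ∀ c, ContinuousOn (G c) (chartAt (Model n) c).target) :
    chartIntegral (fun c z => F c z - G c z) = chartIntegral F - chartIntegral G := by
  rw [chartIntegral_eq_sum, chartIntegral_eq_sum, chartIntegral_eq_sum, ← Finset.sum_sub_distrib]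
  refine Finset.sum_congr rfl fun c _ => ?_
  rw [← integral_sub (integrableOn_chartPartition_mul (hF c))
    (integrableOn_chartPartition_mul (hG c))]
  simp only [mul_sub]

theorem chartIntegral_congr {F G : M → Model n → 𝕜}
    (h : ∀ c, Set.EqOn (F c) (G c) (chartAt (Model n) c).target) :
    chartIntegral F = chartIntegral G := by
  refine finsum_congr fun c =>
    setIntegral_congr_fun (chartAt (Model n) c).open_target.measurableSet fun z hz => ?_
  simp only [h c hz]

theorem chartIntegral_ofReal (F : M → Model n → ℝ) :
    chartIntegral (fun c z => (F c z : ℂ)) = ((chartIntegral F : ℝ) : ℂ) := by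
  rw [chartIntegral_eq_sum, chartIntegral_eq_sum, Complex.ofReal_sum]
  refine Finset.sum_congr rfl fun c _ => ?_
  rw [← integral_complex_ofReal]
  congr 1
  funext z
  simp

theorem chartIntegral_conj (F : M → Model n → ℂ) :
    chartIntegral (fun c z => starRingEnd ℂ (F c z)) = starRingEnd ℂ (chartIntegral F) := by
  rw [chartIntegral_eq_sum, chartIntegral_eq_sum, map_sum]
  refine Finset.sum_congr rfl fun c _ => ?_
  rw [← integral_conj]
  congr 1
  funext z
  simp

/-- All summands are nonnegative. Some cutoff is positive at `x`, and there the continuous integrand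
is nonzero on a nonempty open set, which has positive measure. -/
theorem chartIntegral_pos {F : M → Model n → ℝ}
    (hF : ∀ c, ContinuousOn (F c) (chartAt (Model n) c).target)
    (h0 : ∀ c, ∀ z ∈ (chartAt (Model n) c).target, 0 ≤ F c z) {x : M}
    (hx : ∀ c, x ∈ (chartAt (Model n) c).source → 0 < F c (chartAt (Model n) c x)) :
    0 < chartIntegral F := by
  have hnn (c : M) : ∀ z ∈ (chartAt (Model n) c).target,
      0 ≤ (chartPartition n M c ((chartAt (Model n) c).symm z) : ℝ) * F c z :=
    fun z hz => mul_nonneg ((chartPartition n M).nonneg c _) (h0 c z hz)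
  have hm (c : M) := (chartAt (Model n) c).open_target.measurableSet
  obtain ⟨c, hc⟩ := (chartPartition n M).exists_pos (Set.mem_univ x)
  have hxs : x ∈ (chartAt (Model n) c).source :=
    (exists_chart_partition n M).choose_spec c (subset_tsupport _ hc.ne')
  rw [chartIntegral_eq_sum]
  refine Finset.sum_pos' (fun c _ => setIntegral_nonneg (hm c) (hnn c)) ⟨c, ?_, ?_⟩
  · rw [Set.Finite.mem_toFinset]
    exact ⟨x, hc.ne'⟩
  have hcont := continuousOn_chartPartition_mul (hF c)
  refine (setIntegral_pos_iff_support_of_nonneg_ae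
    ((ae_restrict_iff' (hm c)).2 (Filter.Eventually.of_forall (hnn c)))
    (integrableOn_chartPartition_mul (hF c))).2 ?_
  have ho := hcont.isOpen_inter_preimage (chartAt (Model n) c).open_target isOpen_compl_singleton
    (t := {(0 : ℝ)}ᶜ)
  rw [Set.inter_comm]
  refine ho.measure_pos volume ⟨chartAt (Model n) c x, (chartAt (Model n) c).map_source hxs, ?_⟩
  have : (chartAt (Model n) c).symm (chartAt (Model n) c x) = x :=
    (chartAt (Model n) c).left_inv hxs
  simp only [Set.mem_preimage, this, Set.mem_compl_iff, Set.mem_singleton_iff]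
  exact (mul_pos hc (hx c hxs)).ne'

end ChartIntegral

/-! ### Components of one-forms and the dual pairing -/

section PairingsPointwise

variable {n : ℕ}

theorem form_one_apply (α : Alt n 1) (u : Model n) :
    α ![u] = ∑ j, ((u j).re * α ![Pi.single j 1] + (u j).im * α ![Pi.single j Complex.I]) := by
  have e (a : Model n) : Function.update ![u] 0 a = ![a] := by
    ext j : 1
    fin_cases j
    rfl
  let ℓ : Model n →ₗ[ℝ] ℂ :=
    { toFun := fun u => α ![u]
      map_add' := fun x y => by
        have h := α.map_update_add ![u] 0 x y
        rwa [e, e, e] at h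
      map_smul' := fun c x => by
        have h := α.map_update_smul ![u] 0 c x
        rwa [e, e] at h }
  have hu : u = ∑ j, ((u j).re • (Pi.single j 1 : Model n) +
      (u j).im • (Pi.single j Complex.I : Model n)) := by
    ext j
    simp only [Finset.sum_apply, Pi.add_apply, Pi.smul_apply, Pi.single_apply]
    simp [Finset.sum_add_distrib, Finset.sum_ite_eq, Complex.re_add_im]
  change ℓ u = _
  conv_lhs => rw [hu]
  rw [map_sum]
  refine Finset.sum_congr rfl fun j _ => ?_
  rw [map_add, map_smul, map_smul, Complex.real_smul, Complex.real_smul]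
  rfl

/-- The complex linear part of a one-form in terms of its components. -/
theorem hol_part_apply (α : Alt n 1) (u : Model n) :
    (1 / 2) * (α ![u] - Complex.I * α ![mulI n u]) = ∑ j, u j * compHol α j := by
  rw [form_one_apply α u, form_one_apply α (mulI n u), Finset.mul_sum, ← Finset.sum_sub_distrib,
    Finset.mul_sum]
  refine Finset.sum_congr rfl fun j _ => ?_
  simp only [mulI_apply, Pi.smul_apply, smul_eq_mul, Complex.I_mul_re, Complex.I_mul_im, compHol]
  conv_rhs => rw [← Complex.re_add_im (u j)]
  push_cast
  linear_combination ((1 / 2) * (u j).im * α ![Pi.single j Complex.I]) * Complex.I_sq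

theorem compHol_comp (α : Alt n 1) (A : Model n →L[ℂ] Model n) (i : Fin n) :
    compHol (α.compContinuousLinearMap (A.restrictScalars ℝ)) i =
      ((matrixOf A).transpose.mulVec (compHol α)) i := by
  have h := hol_part_apply α (A (Pi.single i 1))
  have h1 : mulI n (A (Pi.single i 1)) = A (Pi.single i Complex.I) := by
    rw [mulI_apply, ← map_smul, ← Pi.single_smul, smul_eq_mul, mul_one]
  have e (u : Model n) : α.compContinuousLinearMap (A.restrictScalars ℝ) ![u] = α ![A u] := by
    rw [ContinuousAlternatingMap.compContinuousLinearMap_apply]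
    congr 1
    ext j : 1
    fin_cases j
    rfl
  rw [compHol, e, e, ← h1, h]
  rfl

/-- A (1,0)-form equals its complex linear part, which its holomorphic components determine. -/
theorem eq_zero_of_compHol_eq_zero {α : Alt n 1}
    (hα : α.compContinuousLinearMap (mulI n) = Complex.I • α) (h : compHol α = 0) : α = 0 := by
  ext v
  have hv : v = ![v 0] := by
    ext j : 1
    fin_cases j
    rfl
  have h1 := hol_part_apply α (v 0)
  have h2 : α ![mulI n (v 0)] = Complex.I * α ![v 0] := by
    have := congrArg (fun β : Alt n 1 => β ![v 0]) hα
    simp only [ContinuousAlternatingMap.compContinuousLinearMap_apply,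
      ContinuousAlternatingMap.smul_apply, smul_eq_mul] at this
    rw [← this]
    congr 1
    ext j : 1
    fin_cases j
    rfl
  rw [h2, h] at h1
  simp only [Pi.zero_apply, mul_zero, Finset.sum_const_zero] at h1
  rw [hv, ContinuousAlternatingMap.coe_zero, Pi.zero_apply]
  linear_combination h1 + (1 / 2 * α ![v 0]) * Complex.I_sq

/-- The dual pairing `b* H⁻¹ a`. -/
def dualPair (H : Matrix (Fin n) (Fin n) ℂ) (a b : Fin n → ℂ) : ℂ :=
  star b ⬝ᵥ H⁻¹.mulVec a

/-- Covectors transform by Aᵀ and the inverse metric by the inverse factors, so the Jacobians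
cancel. -/
theorem dualPair_congr {H A : Matrix (Fin n) (Fin n) ℂ} (hA : A.det ≠ 0) (a b : Fin n → ℂ) :
    dualPair (A.transpose * H * A.map (starRingEnd ℂ)) (A.transpose.mulVec a)
      (A.transpose.mulVec b) = dualPair H a b := by
  have hAu : IsUnit A.transpose.det := by
    rw [Matrix.det_transpose]
    exact hA.isUnit
  have hB : A.map (starRingEnd ℂ) = A.transpose.conjTranspose := by
    ext i j
    rfl
  have hBu : IsUnit A.transpose.conjTranspose.det := by
    rw [Matrix.det_conjTranspose]
    exact hAu.star
  rw [dualPair, dualPair, hB, Matrix.mul_inv_rev, Matrix.mul_inv_rev, Matrix.star_mulVec,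
    ← Matrix.mulVec_mulVec, ← Matrix.mulVec_mulVec, Matrix.mulVec_mulVec (M := A.transpose⁻¹),
    Matrix.nonsing_inv_mul _ hAu, Matrix.one_mulVec, ← Matrix.dotProduct_mulVec,
    Matrix.mulVec_mulVec (M := A.transpose.conjTranspose), Matrix.mul_nonsing_inv _ hBu,
    Matrix.one_mulVec]

open scoped ComplexOrder in
theorem dualPair_self {H : Matrix (Fin n) (Fin n) ℂ} (hH : H.PosDef) (a : Fin n → ℂ) :
    dualPair H a a = ((dualPair H a a).re : ℂ) ∧ 0 ≤ (dualPair H a a).re ∧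
      (a ≠ 0 → 0 < (dualPair H a a).re) := by
  have h1 := Complex.le_def.1 (hH.inv.posSemidef.dotProduct_mulVec_nonneg a)
  exact ⟨Complex.ext rfl h1.2.symm, h1.1,
    fun ha => (Complex.lt_def.1 (hH.inv.dotProduct_mulVec_pos ha)).1⟩

theorem dualPair_sub_left (H : Matrix (Fin n) (Fin n) ℂ) (a a' b : Fin n → ℂ) :
    dualPair H (a - a') b = dualPair H a b - dualPair H a' b := by
  rw [dualPair, Matrix.mulVec_sub, dotProduct_sub, dualPair, dualPair]

theorem continuousOn_dualPair {X : Type*} [TopologicalSpace X] {s : Set X}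
    {H : X → Matrix (Fin n) (Fin n) ℂ} {a b : X → Fin n → ℂ} (hH : ContinuousOn H s)
    (hdet : ∀ x ∈ s, (H x).det ≠ 0) (ha : ContinuousOn a s) (hb : ContinuousOn b s) :
    ContinuousOn (fun x => dualPair (H x) (a x) (b x)) s := by
  have hdetc : ContinuousOn (fun x => (H x).det) s :=
    (continuous_id.matrix_det).comp_continuousOn hH
  have hadj : ContinuousOn (fun x => (H x).adjugate) s :=
    (continuous_id.matrix_adjugate).comp_continuousOn hH
  have hinv : ContinuousOn (fun x => (H x)⁻¹) s := by
    simp only [Matrix.inv_def, Ring.inverse_eq_inv']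
    exact (hdetc.inv₀ hdet).smul hadj
  simp only [dualPair, dotProduct, Matrix.mulVec]
  refine continuousOn_finsetSum _ fun i _ => ContinuousOn.mul ?_
    (continuousOn_finsetSum _ fun j _ => ContinuousOn.mul ?_ ?_)
  · exact continuous_star.comp_continuousOn ((continuous_apply i).comp_continuousOn hb)
  · exact (continuous_apply_apply i j).comp_continuousOn hinv
  · exact (continuous_apply j).comp_continuousOn ha

end PairingsPointwise

/-! ### Pairings and complex conjugation -/

section Conjugation

variable {n : ℕ}

@[simp]
theorem conjForm_conjForm {k : ℕ} (α : Alt n k) : conjForm n k (conjForm n k α) = α := by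
  ext v
  simp

theorem compHol_conjForm (α : Alt n 1) (i : Fin n) :
    compHol (conjForm n 1 α) i = starRingEnd ℂ (compBar α i) := by
  simp [compHol, compBar, map_ofNat, sub_eq_add_neg]

/-- Conjugation exchanges ∂/∂z and ∂/∂z̄; restoring their order costs a sign and swaps the indices.
-/
theorem compMixed_conjForm (φ : Alt n 2) (j k : Fin n) :
    compMixed (conjForm n 2 φ) j k = -starRingEnd ℂ (compMixed φ k j) := by
  simp only [compMixed, conjForm_apply, map_mul, map_add, map_sub, map_div₀, map_one, map_ofNat,
    Complex.conj_I]
  rw [alt2_swap φ (Pi.single k 1) (Pi.single j 1),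
    alt2_swap φ (Pi.single k 1) (Pi.single j Complex.I),
    alt2_swap φ (Pi.single k Complex.I) (Pi.single j 1),
    alt2_swap φ (Pi.single k Complex.I) (Pi.single j Complex.I)]
  simp only [map_neg]
  ring

theorem sum_reverse_four {ι R : Type*} [Fintype ι] [AddCommMonoid R] (G : ι → ι → ι → ι → R) :
    ∑ i, ∑ j, ∑ k, ∑ l, G i j k l = ∑ i, ∑ j, ∑ k, ∑ l, G l k j i := by
  let e : ι × ι × ι × ι ≃ ι × ι × ι × ι :=
    { toFun := fun x => (x.2.2.2, x.2.2.1, x.2.1, x.1)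
      invFun := fun x => (x.2.2.2, x.2.2.1, x.2.1, x.1)
      left_inv := fun _ => rfl
      right_inv := fun _ => rfl }
  have h := Equiv.sum_comp e fun x => G x.1 x.2.1 x.2.2.1 x.2.2.2
  simp only [Fintype.sum_prod_type] at h
  exact h.symm

variable {M : Type*} [TopologicalSpace M] [ChartedSpace (Model n) M] (g : HermitianMetric n M)

theorem conj_inv_matrixAt (x : M) (i j : Fin n) :
    starRingEnd ℂ ((g.matrixAt x)⁻¹ i j) = (g.matrixAt x)⁻¹ j i :=
  (hermMatrix_isHermitian (g.compat x) (g.symm x)).inv.apply j i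

theorem pair11_conjForm (x : M) (φ ψ : Alt n 2) :
    g.pair11 x (conjForm n 2 φ) (conjForm n 2 ψ) = starRingEnd ℂ (g.pair11 x φ ψ) := by
  simp only [HermitianMetric.pair11, map_sum, map_mul, conj_inv_matrixAt, Complex.conj_conj,
    compMixed_conjForm, map_neg]
  -- Conjugation transposes both inverse matrices and both components; the renaming (i, j, k, l) →
  -- (l, k, j, i) undoes this, and the two signs cancel.
  rw [sum_reverse_four]
  refine Finset.sum_congr rfl fun i _ => Finset.sum_congr rfl fun j _ =>
    Finset.sum_congr rfl fun k _ => Finset.sum_congr rfl fun l _ => ?_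
  ring

theorem pair10_conjForm (x : M) (α β : Alt n 1) :
    g.pair10 x (conjForm n 1 α) (conjForm n 1 β) = starRingEnd ℂ (g.pair01 x α β) := by
  simp only [HermitianMetric.pair10, HermitianMetric.pair01, map_sum, map_mul, conj_inv_matrixAt,
    compHol_conjForm]

theorem conjForm_kahlerForm (x : M) : conjForm n 2 (g.kahlerForm x) = g.kahlerForm x := by
  ext v
  exact Complex.conj_ofReal _

end Conjugation

/-! ### Pairings as continuous densities in charts -/

section PairingsInCharts

variable {n : ℕ} {M : Type*} [TopologicalSpace M] [ChartedSpace (Model n) M]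

theorem continuousOn_compHol_inChart {α : DForm n M 1} (hα : IsSmooth α) (c : M) :
    ContinuousOn (fun z => compHol (inChart α c z)) (chartAt (Model n) c).target := by
  have h (u : Model n) : ContinuousOn (fun z => inChart α c z ![u]) (chartAt (Model n) c).target :=
    (continuous_eval_const (F := Alt n 1) ![u]).comp_continuousOn (hα c).continuousOn
  refine continuousOn_pi.2 fun i => ?_
  exact continuousOn_const.mul ((h _).sub (continuousOn_const.mul (h _)))

variable (g : HermitianMetric n M)

/-- The density of `∫ g(α, β) dV` for `(1,0)`-forms in the chart `chartAt c`. -/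
def pairDensity (α β : DForm n M 1) (c : M) (z : Model n) : ℂ :=
  dualPair (g.matrixInChart c z) (compHol (inChart α c z)) (compHol (inChart β c z)) *
    (g.matrixInChart c z).det

variable [IsManifold 𝓘(ℂ, Model n) ω M]

/-- The pointwise pairing uses the coordinates preferred at each point, which need not vary
continuously; invariance moves it to one fixed chart. -/
theorem pair10_symm_eq_dualPair (α β : DForm n M 1) {c : M} {z : Model n}
    (hz : z ∈ (chartAt (Model n) c).target) :
    g.pair10 ((chartAt (Model n) c).symm z) (α ((chartAt (Model n) c).symm z))
        (β ((chartAt (Model n) c).symm z)) =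
      dualPair (g.matrixInChart c z) (compHol (inChart α c z)) (compHol (inChart β c z)) := by
  have hc (γ : DForm n M 1) : compHol (inChart γ c z) =
      (matrixOf (chartInvDerivC c z)).transpose.mulVec
        (compHol (γ ((chartAt (Model n) c).symm z))) := by
    funext i
    exact compHol_comp _ _ _
  rw [matrixInChart_eq_matrixAt, hc, hc,
    dualPair_congr (matrixOf_det_ne_zero (chartInvDerivC_injective hz))]
  simp only [HermitianMetric.pair10, dualPair, dotProduct, Matrix.mulVec, Pi.star_apply,
    Finset.mul_sum]
  rw [Finset.sum_comm]
  refine Finset.sum_congr rfl fun i _ => Finset.sum_congr rfl fun j _ => ?_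
  rw [starRingEnd_apply]
  ring

theorem continuousOn_pairDensity {α β : DForm n M 1} (hα : IsSmooth α) (hβ : IsSmooth β) (c : M) :
    ContinuousOn (pairDensity g α β c) (chartAt (Model n) c).target := by
  have hH : ContinuousOn (g.matrixInChart c) (chartAt (Model n) c).target :=
    continuousOn_pi.2 fun i => continuousOn_pi.2 fun j =>
      (contDiffOn_matrixInChart g c i j).continuousOn
  refine (continuousOn_dualPair hH (fun z hz h => ?_) (continuousOn_compHol_inChart hα c)
    (continuousOn_compHol_inChart hβ c)).mul (contDiffOn_det_matrixInChart g c).continuousOn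
  have h1 := (matrixInChart_det_pos g hz).1
  simp [h] at h1

end PairingsInCharts

/-! ### Uniqueness and conjugation of the adjoints -/

section Adjoints

variable {n : ℕ} {M : Type*} [TopologicalSpace M] [ChartedSpace (Model n) M]
  [CompactSpace M] [T2Space M] (g : HermitianMetric n M)

theorem integral_eq_chartIntegral (f : M → ℂ) : g.integral f =
    chartIntegral fun c z => f ((chartAt (Model n) c).symm z) * (g.matrixInChart c z).det := rfl

/-- The default value 0 is also smooth of type (0,1), so no existence theorem for the adjoint
enters. -/
theorem delStar_spec (φ : DForm n M 2) :
    IsSmooth (g.delStar φ) ∧ HasType 0 1 (g.delStar φ) := by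
  unfold HermitianMetric.delStar
  split_ifs with h
  · exact ⟨h.choose_spec.1, h.choose_spec.2.1⟩
  · exact ⟨fun c => contDiffOn_const (c := (0 : Alt n 1)), rfl, fun x c v => (mul_zero _).symm⟩

variable [IsManifold 𝓘(ℂ, Model n) ω M]

theorem integral_conj (f : M → ℂ) :
    g.integral (fun x => starRingEnd ℂ (f x)) = starRingEnd ℂ (g.integral f) := by
  rw [integral_eq_chartIntegral, integral_eq_chartIntegral, ← chartIntegral_conj]
  refine chartIntegral_congr fun c z hz => ?_
  simp only [map_mul]
  rw [← (matrixInChart_det_pos g hz).2, Complex.conj_ofReal]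

/-- Test the identity for τ against the conjugate of a (1,0)-form, then conjugate both sides; the
volume density is real. -/
theorem isDelbarStar_conj {φ : DForm n M 2} {τ : DForm n M 1} (h : g.IsDelStar φ τ) :
    g.IsDelbarStar (fun x => conjForm n 2 (φ x)) (fun x => conjForm n 1 (τ x)) := by
  refine ⟨h.1.conj, h.2.1.conj, fun α hα tα => ?_⟩
  have h1 := h.2.2 _ hα.conj tα.conj
  have hd : del (fun x => conjForm n 1 (α x)) = fun x => conjForm n 2 (delbar α x) := by
    rw [del_eq, delbar_eq, twistedDM_conjForm hα, map_neg, Complex.conj_I, neg_neg]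
  have h2 := congrArg (starRingEnd ℂ) h1
  rw [hd, ← integral_conj, ← integral_conj] at h2
  simpa only [← pair11_conjForm, ← pair10_conjForm, conjForm_conjForm] using h2

theorem isDelStar_conj {φ : DForm n M 2} {σ : DForm n M 1} (h : g.IsDelbarStar φ σ) :
    g.IsDelStar (fun x => conjForm n 2 (φ x)) (fun x => conjForm n 1 (σ x)) := by
  refine ⟨h.1.conj, h.2.1.conj, fun α hα tα => ?_⟩
  have h1 := h.2.2 _ hα.conj tα.conj
  have hd : delbar (fun x => conjForm n 1 (α x)) = fun x => conjForm n 2 (del α x) := by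
    rw [del_eq, delbar_eq, twistedDM_conjForm hα, Complex.conj_I]
  have h2 (x : M) : g.pair10 x (σ x) (conjForm n 1 (α x)) =
      starRingEnd ℂ (g.pair01 x (conjForm n 1 (σ x)) (α x)) := by
    rw [← pair10_conjForm, conjForm_conjForm]
  have h3 (x : M) : g.pair11 x (φ x) (conjForm n 2 (del α x)) =
      starRingEnd ℂ (g.pair11 x (conjForm n 2 (φ x)) (del α x)) := by
    rw [← pair11_conjForm, conjForm_conjForm]
  rw [hd] at h1
  simp only [h2, h3, integral_conj] at h1
  exact (starRingEnd ℂ).injective h1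

theorem integral_pair10 (α β : DForm n M 1) :
    g.integral (fun x => g.pair10 x (α x) (β x)) = chartIntegral (pairDensity g α β) := by
  rw [integral_eq_chartIntegral]
  refine chartIntegral_congr fun c z hz => ?_
  simp only [pair10_symm_eq_dualPair g α β hz, pairDensity]

/-- The `L²`-product of `(1,0)`-forms is definite. -/
theorem eq_zero_of_integral_pair10_self {δ : DForm n M 1} (hδ : IsSmooth δ) (tδ : HasType 1 0 δ)
    (h : g.integral (fun x => g.pair10 x (δ x) (δ x)) = 0) : δ = 0 := by
  by_contra hne
  obtain ⟨x, hx⟩ := Function.ne_iff.1 hne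
  have hreal (c : M) {z : Model n} (hz : z ∈ (chartAt (Model n) c).target) :
      pairDensity g δ δ c z = ((pairDensity g δ δ c z).re : ℂ) ∧ 0 ≤ (pairDensity g δ δ c z).re ∧
        (compHol (inChart δ c z) ≠ 0 → 0 < (pairDensity g δ δ c z).re) := by
    obtain ⟨h1, h2, h3⟩ := dualPair_self (matrixInChart_posDef g hz) (compHol (inChart δ c z))
    obtain ⟨h4, h5⟩ := matrixInChart_det_pos g hz
    have e : pairDensity g δ δ c z = ((dualPair (g.matrixInChart c z) (compHol (inChart δ c z))
        (compHol (inChart δ c z))).re * (g.matrixInChart c z).det.re : ℝ) := by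
      rw [Complex.ofReal_mul, ← h1, h5, pairDensity]
    rw [e, Complex.ofReal_re]
    exact ⟨rfl, mul_nonneg h2 h4.le, fun h0 => mul_pos (h3 h0) h4⟩
  rw [integral_pair10, chartIntegral_congr (G := fun c z => ((pairDensity g δ δ c z).re : ℂ))
    fun c z hz => (hreal c hz).1, chartIntegral_ofReal] at h
  refine (chartIntegral_pos (F := fun c z => (pairDensity g δ δ c z).re)
    (fun c => Complex.continuous_re.comp_continuousOn (continuousOn_pairDensity g hδ hδ c))
    (fun c z hz => (hreal c hz).2.1) (x := x) fun c hc => ?_).ne' (by exact_mod_cast h)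
  have hz := (chartAt (Model n) c).map_source hc
  refine (hreal c hz).2.2 fun h0 => hx ?_
  have h1 := compHol_comp (δ x) (chartInvDerivC c (chartAt (Model n) c x))
  have h2 : inChart δ c (chartAt (Model n) c x) = (δ x).compContinuousLinearMap
      ((chartInvDerivC c (chartAt (Model n) c x)).restrictScalars ℝ) := by
    rw [inChart, (chartAt (Model n) c).left_inv hc, chartInvDeriv]
  have h3 : (matrixOf (chartInvDerivC c (chartAt (Model n) c x))).transpose.mulVec
      (compHol (δ x)) = 0 := by
    rw [← h0, h2]
    exact (funext h1).symm
  have h4 : compHol (δ x) = 0 := by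
    refine Matrix.eq_zero_of_mulVec_eq_zero ?_ h3
    rw [Matrix.det_transpose]
    exact matrixOf_det_ne_zero (chartInvDerivC_injective hz)
  refine eq_zero_of_compHol_eq_zero ?_ h4
  have h5 := tδ.comp_mulI x
  rwa [pow_one, pow_zero, mul_one] at h5

/-- The difference of two candidates is an admissible test form, so it is orthogonal to itself. -/
theorem isDelbarStar_unique {φ : DForm n M 2} {σ σ' : DForm n M 1} (h : g.IsDelbarStar φ σ)
    (h' : g.IsDelbarStar φ σ') : σ = σ' := by
  have hs : IsSmooth (σ - σ') := fun c => (h.1 c).sub (h'.1 c)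
  have ht : HasType 1 0 (σ - σ') := by
    refine ⟨rfl, fun x c v => ?_⟩
    change σ x _ - σ' x _ = _ * (σ x v - σ' x v)
    rw [h.2.1.2, h'.2.1.2, mul_sub]
  have hint := (h.2.2 _ hs ht).symm.trans (h'.2.2 _ hs ht)
  refine sub_eq_zero.1 (eq_zero_of_integral_pair10_self g hs ht ?_)
  rw [integral_pair10, integral_pair10] at hint
  rw [integral_pair10, ← sub_eq_zero.2 hint, ← chartIntegral_sub
    (continuousOn_pairDensity g h.1 hs) (continuousOn_pairDensity g h'.1 hs)]
  refine chartIntegral_congr fun c z _ => ?_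
  have e : compHol (inChart (σ - σ') c z) =
      compHol (inChart σ c z) - compHol (inChart σ' c z) := by
    funext i
    have e1 (v : Fin 1 → Model n) :
        inChart (σ - σ') c z v = inChart σ c z v - inChart σ' c z v := rfl
    simp only [compHol, e1, Pi.sub_apply]
    ring
  change dualPair _ (compHol (inChart (σ - σ') c z)) _ * _ = dualPair _ _ _ * _ - dualPair _ _ _ * _
  rw [← sub_mul, ← dualPair_sub_left, ← e]

/-- `∂̄*ω` is the complex conjugate of `∂*ω`. -/
theorem delbarStar_kahlerForm : g.delbarStar g.kahlerForm =
    fun x => conjForm n 1 (g.delStar g.kahlerForm x) := by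
  have hω : (fun x => conjForm n 2 (g.kahlerForm x)) = g.kahlerForm :=
    funext (conjForm_kahlerForm g)
  by_cases h : ∃ τ, g.IsDelStar g.kahlerForm τ
  · have h1 := isDelbarStar_conj g h.choose_spec
    rw [hω] at h1
    have h2 : ∃ σ, g.IsDelbarStar g.kahlerForm σ := ⟨_, h1⟩
    rw [HermitianMetric.delbarStar, HermitianMetric.delStar, dif_pos h, dif_pos h2]
    exact isDelbarStar_unique g h2.choose_spec h1
  -- If one adjoint is missing, so is the other; both then take the default 0, which is its own
  -- conjugate.
  · have h2 : ¬∃ σ, g.IsDelbarStar g.kahlerForm σ := fun ⟨σ, hσ⟩ => by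
      have h3 := isDelStar_conj g hσ
      rw [hω] at h3
      exact h ⟨_, h3⟩
    rw [HermitianMetric.delbarStar, HermitianMetric.delStar, dif_neg h, dif_neg h2]
    funext x
    exact (map_zero (conjForm n 1)).symm

end Adjoints

/-! ### Integral of the top power -/

section TopPower

theorem tensorPow_apply {n : ℕ} (φ : Alt n 2) (m : ℕ) (v : Fin (2 * m) → Model n) :
    tensorPow φ m v = ∏ i : Fin m, φ ![v ⟨2 * i, by omega⟩, v ⟨2 * i + 1, by omega⟩] := rfl

theorem wedgePow_compContinuousLinearMap {n : ℕ} (φ : Alt n 2) (A : Model n →L[ℝ] Model n) (m : ℕ) :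
    wedgePow (φ.compContinuousLinearMap A) m = (wedgePow φ m).compContinuousLinearMap A := by
  ext v
  rw [ContinuousAlternatingMap.compContinuousLinearMap_apply, wedgePow, wedgePow,
    ContinuousAlternatingMap.smul_apply, ContinuousAlternatingMap.smul_apply,
    ContinuousMultilinearMap.alternatization_apply_apply,
    ContinuousMultilinearMap.alternatization_apply_apply]
  congr 1
  refine Finset.sum_congr rfl fun σ _ => ?_
  congr 1
  rw [tensorPow_apply, tensorPow_apply]
  refine Finset.prod_congr rfl fun i _ => ?_
  rw [ContinuousAlternatingMap.compContinuousLinearMap_apply]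
  congr 1
  ext j : 1
  fin_cases j <;> rfl

/-- φ(Ju, JJu) = -φ(Ju, u) = φ(u, Ju), so positivity of the (1,1)-part is the taming condition on φ
itself. -/
theorem part11_apply_mulI {n : ℕ} {M : Type*} (φ : DForm n M 2) (x : M) (u : Model n) :
    part11 φ x ![u, mulI n u] = φ x ![u, mulI n u] := by
  have h : (φ x).compContinuousLinearMap (mulI n) ![u, mulI n u] = φ x ![u, mulI n u] := by
    have e : ⇑(mulI n) ∘ ![u, mulI n u] = ![mulI n u, (-1 : ℝ) • u] := by
      ext j : 1
      fin_cases j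
      · rfl
      · simpa using mulI_mulI u
    rw [ContinuousAlternatingMap.compContinuousLinearMap_apply, e, alt2_smul_right, alt2_swap]
    simp
  change (1 / 2 : ℂ) • (φ x ![u, mulI n u] + (φ x).compContinuousLinearMap (mulI n) _) = _
  rw [h, smul_eq_mul]
  ring

variable {n : ℕ} {M : Type*} [TopologicalSpace M] [ChartedSpace (Model n) M]

theorem inChart_wedgePow (φ : DForm n M 2) (m : ℕ) (c : M) (z : Model n) :
    inChart (fun x => wedgePow (φ x) m) c z = wedgePow (inChart φ c z) m :=
  (wedgePow_compContinuousLinearMap _ _ _).symm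

theorem kahlerForm_apply_mulI (g : HermitianMetric n M) (x : M) (u : Model n) :
    g.kahlerForm x ![u, mulI n u] = (g.inner x u u : ℂ) := by
  rw [← g.compat]
  rfl

variable [CompactSpace M] [T2Space M] [IsManifold 𝓘(ℂ, Model n) ω M]

/-- The top power of a Hermitian-symplectic form has positive integral. -/
theorem IsHermitianSymplectic.integralForm_wedgePow_pos [Nonempty M] {φ : DForm n M 2}
    (hφ : IsHermitianSymplectic φ) :
    ∃ r : ℝ, 0 < r ∧ integralForm (fun x => wedgePow (φ x) n) = (r : ℂ) := by
  have hre (c : M) (z : Model n) (v : Fin 2 → Model n) : (inChart φ c z v).im = 0 := hφ.real _ _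
  let r (c : M) (z : Model n) : ℝ :=
    (1 / 2) ^ n * pfaffianSum (fun u w => (inChart φ c z ![u, w]).re) (realFrame n)
  have hr (c : M) (z : Model n) : wedgePow (inChart φ c z) n (realFrame n) = (r c z : ℂ) :=
    wedgePow_eq_pfaffianSum (fun u w => Complex.ext rfl (hre c z _)) _
  -- The differential of the inverse chart is injective and complex linear, so the chart expression
  -- of φ tames multiplication by i.
  have hpos (c : M) (z : Model n) (hz : z ∈ (chartAt (Model n) c).target) : 0 < r c z := by
    obtain ⟨s, hs, h⟩ := wedgePow_realFrame_pos (φ := inChart φ c z) (hre c z) fun u hu => by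
      have hA : chartInvDeriv c z (mulI n u) = mulI n (chartInvDeriv c z u) :=
        (chartInvDerivC c z).map_smul Complex.I u
      have e : ⇑(chartInvDeriv c z) ∘ ![u, mulI n u] =
          ![chartInvDeriv c z u, mulI n (chartInvDeriv c z u)] := by
        rw [← hA]
        ext j : 1
        fin_cases j <;> rfl
      rw [inChart, ContinuousAlternatingMap.compContinuousLinearMap_apply, e, ← part11_apply_mulI]
      exact hφ.pos _ _ fun h0 =>
        hu (chartInvDerivC_injective hz (h0.trans (map_zero (chartInvDerivC c z)).symm))
    rw [hr] at h
    rwa [Complex.ofReal_injective h]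
  have hcont (c : M) : ContinuousOn (r c) (chartAt (Model n) c).target := by
    refine continuousOn_const.mul (continuousOn_finsetSum _ fun σ _ => continuousOn_const.mul
      (continuousOn_finsetProd _ fun i _ => Complex.continuous_re.comp_continuousOn ?_))
    exact (continuous_eval_const (F := Alt n 2) _).comp_continuousOn (hφ.smooth c).continuousOn
  obtain ⟨x⟩ := ‹Nonempty M›
  refine ⟨chartIntegral r, chartIntegral_pos hcont (fun c z hz => (hpos c z hz).le)
    (x := x) fun c hc => hpos c _ ((chartAt (Model n) c).map_source hc), ?_⟩
  rw [← chartIntegral_ofReal]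
  refine chartIntegral_congr (F := fun c z => inChart (fun x => wedgePow (φ x) n) c z (realFrame n))
    fun c z _ => ?_
  simp only [inChart_wedgePow, hr]

end TopPower

/-! ### Static metrics -/

section Static

variable {n : ℕ} {M : Type*} [TopologicalSpace M] [ChartedSpace (Model n) M]
  [CompactSpace M] [T2Space M] (g : HermitianMetric n M) {lam : ℝ}

/-- On an empty manifold every integral is 0, against volume one; a point is needed for strict
positivity of the top power. -/
theorem HermitianMetric.IsStatic.nonempty {g : HermitianMetric n M} (hg : g.IsStatic lam) :
    Nonempty M := by
  by_contra h
  rw [not_nonempty_iff] at h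
  have h1 := hg.volume
  rw [HermitianMetric.integral, finsum_of_isEmpty] at h1
  exact zero_ne_one h1

variable [IsManifold 𝓘(ℂ, Model n) ω M]

theorem isSmooth_delbarStar_kahlerForm : IsSmooth (g.delbarStar g.kahlerForm) := by
  rw [delbarStar_kahlerForm]
  exact (delStar_spec g _).1.conj

theorem part11_tildeForm : part11 (g.tildeForm lam) = g.kahlerForm := by
  refine part11_kahlerForm_sub g _ (delStar_spec g _).1 (isSmooth_delbarStar_kahlerForm g)
    (delStar_spec g _).2 ?_
  rw [delbarStar_kahlerForm]
  exact (delStar_spec g _).2.conj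

theorem isHermitianSymplectic_tildeForm {g : HermitianMetric n M} (hlam : lam ≠ 0)
    (hg : g.IsStatic lam) : IsHermitianSymplectic (g.tildeForm lam) where
  smooth := isSmooth_kahlerForm_sub g _ (delStar_spec g _).1 (isSmooth_delbarStar_kahlerForm g)
  real := by
    have h := isReal_kahlerForm_sub g lam⁻¹ (delStar_spec g g.kahlerForm).1
      (delbarStar_kahlerForm g)
    rwa [Complex.ofReal_inv] at h
  closed := extD_kahlerForm_sub g (delStar_spec g _).1 (isSmooth_delbarStar_kahlerForm g) hlam
    hg.eqn
  pos x u hu := by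
    rw [part11_tildeForm, kahlerForm_apply_mulI, Complex.ofReal_re]
    exact g.pos x u hu

end Static

end HermGeom

end

theorem mainTheorem6 (n : ℕ) (M : Type*) [TopologicalSpace M] [T2Space M] [CompactSpace M]
    [ChartedSpace (HermGeom.Model n) M]
    [IsManifold 𝓘(ℂ, HermGeom.Model n) ω M]
    (g : HermGeom.HermitianMetric n M) (lam : ℝ) (hlam : lam ≠ 0) (hg : g.IsStatic lam) :
    HermGeom.HermitianSymplecticManifold n M ∧
    HermGeom.IsHermitianSymplectic (g.tildeForm lam) ∧
    HermGeom.part11 (g.tildeForm lam) = g.kahlerForm ∧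
    ∃ r : ℝ, 0 < r ∧
      HermGeom.integralForm (fun x => HermGeom.wedgePow (g.tildeForm lam x) n) = (r : ℂ) := by
  have h := HermGeom.isHermitianSymplectic_tildeForm hlam hg
  have := hg.nonempty
  exact ⟨⟨_, h⟩, h, HermGeom.part11_tildeForm g, h.integralForm_wedgePow_pos⟩
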